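/- Let $I=[0,1)$ and let $\mathfrak a:I\to I$ be the von Neumann–Kakutani map, $\mathfrak a(x)=x-(1-3\cdot 2^{-n})$ for $x\in[1-2^{1-n},1-2^{-n})$, $n\ge 1$. Let $q\ge 1$, let $\pi$ be a permutation of $\{0,\dots,q-1\}$, let $R_\pi:I\to I$ be the map that translates $[k/q,(k+1)/q)$ onto $[\pi(k)/q,(\pi(k)+1)/q)$ for every $k$, and let $F_\pi=\mathfrak a\circ R_\pi$ (the rotated odometer). Let $I_{per}$ be the set of periodic points of $F_\pi$ in $I$ and $I_{np}=I\setminus I_{per}$. Compactification. Let $D_0\subset I$ consist of $0$, the points $R_\pi^{-1}(1-2^{-n})$ $(n\ge 0)$, and the discontinuity points of $F_\pi$ on $I$. Let $D$ be the set of all $x\in I$ such that $F_\pi^n(d)=x$ or $F_\pi^n(x)=d$ for some $d\in D_0$, $n\ge 0$. Let $I^*$ be obtained from $I$ by adding the point $1^-=1$ and, for every $x\in D\setminus\{0\}$, a point $x^-$; the points of $I$ are also written $x^+$. Order $I^*$ by position, with $x^-<x^+$, and give it the order topology. Let $F_\pi^*:I^*\to I^*$ be equal to $F_\pi$ on $I$,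 and let $F_\pi^*(x^-)$ be the limit in $I^*$ of $F_\pi(y)$ as $y\in I$ increases to $x$. Let $I^*_{per}$ be the union of all $[x^+,y^-]\subset I^*$ with $x\in D$, $y\in D\cup\{1\}$, $x<y$, $[x,y)\subset I_{per}$, and let $I^*_{np}=I^*\setminus I^*_{per}$. Theorem. For every $q\ge1$ and every permutation $\pi$ of $q$ symbols: 1. $(I_{np},F_\pi)$ has at most $q$ ergodic invariant Borel probability measures. 2. There is exactly one minimal set $I^*_{min}$ of $F^*_\pi$ contained in $I^*_{np}$ (a non-empty closed set, mapped into itself by $F_\pi^*$, with no proper subset having these properties), and $(I^*_{min},F^*_\pi)$ is uniquely ergodic: it has exactly one $F^*_\pi$-invariant Borel probability measure. -/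

import Mathlib

open Set Filter Topology MeasureTheory

noncomputable section

namespace RotatedOdometer

/-- The half-open unit interval `I = [0,1)`, with the topology and Borel structure of `ℝ`. -/
abbrev UI : Type := Ico (0 : ℝ) 1

/-- The point `0` of `I`. -/
def zero : UI := ⟨0, by simp⟩

theorem exists_lt_index (x : UI) : ∃ n : ℕ, (x : ℝ) < 1 - (1 / 2 : ℝ) ^ n := by
  obtain ⟨n, hn⟩ := exists_pow_lt_of_lt_one (sub_pos.2 x.2.2) (by norm_num : (1 / 2 : ℝ) < 1)
  exact ⟨n, by linarith⟩

open Classical in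
/-- The index `n ≥ 1` of the interval `I_n = [1 - 2^{1-n}, 1 - 2^{-n})` containing `x`. -/
def index (x : UI) : ℕ := Nat.find (exists_lt_index x)

theorem index_pos (x : UI) : 1 ≤ index x := by
  classical
  rcases Nat.eq_zero_or_pos (index x) with h | h
  · have h1 : (x : ℝ) < 1 - (1 / 2 : ℝ) ^ (index x) := Nat.find_spec (exists_lt_index x)
    have h0 := x.2.1
    rw [h] at h1
    norm_num at h1
    linarith
  · exact h

theorem lt_index (x : UI) : (x : ℝ) < 1 - (1 / 2 : ℝ) ^ (index x) := by
  classical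
  exact Nat.find_spec (exists_lt_index x)

theorem index_le (x : UI) : 1 - 2 * (1 / 2 : ℝ) ^ (index x) ≤ (x : ℝ) := by
  classical
  have hp := index_pos x
  have h : ¬ ((x : ℝ) < 1 - (1 / 2 : ℝ) ^ (index x - 1)) :=
    Nat.find_min (exists_lt_index x) (Nat.sub_lt hp one_pos)
  obtain ⟨m, hm⟩ : ∃ m, index x = m + 1 := ⟨index x - 1, by omega⟩
  rw [hm] at h ⊢
  simp only [Nat.add_sub_cancel, not_lt] at h
  rw [pow_succ]
  linarith

/-- The von Neumann-Kakutani map: `x ↦ x - (1 - 3 · 2^{-n})` for `x ∈ [1 - 2^{1-n}, 1 - 2^{-n})`,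
`n ≥ 1`. -/
def kakutani (x : UI) : UI :=
  ⟨(x : ℝ) - (1 - 3 * (1 / 2 : ℝ) ^ (index x)), by
    have h1 := lt_index x
    have h2 := index_le x
    have h3 : (0 : ℝ) < (1 / 2 : ℝ) ^ (index x) := by positivity
    have h4 : (1 / 2 : ℝ) ^ (index x) ≤ 1 / 2 := by
      simpa using pow_le_pow_of_le_one (by norm_num : (0 : ℝ) ≤ 1 / 2) (by norm_num) (index_pos x)
    constructor <;> linarith⟩

variable {q : ℕ} [NeZero q]

/-- The index `k` of the interval `[k/q, (k+1)/q)` containing `x`. -/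
def block (q : ℕ) [NeZero q] (x : UI) : Fin q :=
  ⟨⌊(q : ℝ) * x⌋₊, by
    have hq : (0 : ℝ) < q := by exact_mod_cast Nat.pos_of_ne_zero (NeZero.ne q)
    rw [Nat.floor_lt (mul_nonneg hq.le x.2.1)]
    nlinarith [x.2.2]⟩

/-- The finite interval exchange `R_π`, translating `[k/q, (k+1)/q)` onto
`[π(k)/q, (π(k)+1)/q)`. -/
def exchange (π : Equiv.Perm (Fin q)) (x : UI) : UI :=
  ⟨(x : ℝ) + (((π (block q x) : ℕ) : ℝ) - ((block q x : ℕ) : ℝ)) / q, by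
    have hq : (0 : ℝ) < q := by exact_mod_cast Nat.pos_of_ne_zero (NeZero.ne q)
    have h1 : ((block q x : ℕ) : ℝ) ≤ q * x := Nat.floor_le (mul_nonneg hq.le x.2.1)
    have h2 : (q : ℝ) * x < ((block q x : ℕ) : ℝ) + 1 := Nat.lt_floor_add_one _
    have h3 : ((π (block q x) : ℕ) : ℝ) + 1 ≤ q := by exact_mod_cast (π (block q x)).2
    have h4 : (0 : ℝ) ≤ ((π (block q x) : ℕ) : ℝ) := Nat.cast_nonneg _
    have e : (x : ℝ) + (((π (block q x) : ℕ) : ℝ) - ((block q x : ℕ) : ℝ)) / q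
        = (q * x + ((π (block q x) : ℕ) : ℝ) - ((block q x : ℕ) : ℝ)) / q := by
      field_simp
      ring
    rw [e, mem_Ico, div_lt_one hq]
    exact ⟨div_nonneg (by linarith) hq.le, by linarith⟩⟩

/-- The rotated odometer `F_π`. -/
def rotOdo (π : Equiv.Perm (Fin q)) : UI → UI := kakutani ∘ exchange π

/-- `I_per`: the points with periodic orbit. -/
def perPart (π : Equiv.Perm (Fin q)) : Set UI := Function.periodicPts (rotOdo π)

/-- `I_np`: the aperiodic part. -/
def npPart (π : Equiv.Perm (Fin q)) : Set UI := (perPart π)ᶜ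

/-- The ergodic invariant Borel probability measures of `(I_np, F_π)`, regarded as measures on `I`
that are concentrated on `I_np`. -/
def ergodicMeasures (π : Equiv.Perm (Fin q)) : Set (Measure UI) :=
  {μ | IsProbabilityMeasure μ ∧ μ (npPart π)ᶜ = 0 ∧ Ergodic (rotOdo π) μ}

/-- `D₀`: the left endpoint `0`, the points `R_π⁻¹(1 - 2^{-n})`, and the discontinuities of
`F_π` on `I`. -/
def D₀ (π : Equiv.Perm (Fin q)) : Set UI :=
  {d | d = zero ∨ (∃ n : ℕ, (exchange π d : ℝ) = 1 - (1 / 2 : ℝ) ^ n) ∨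
    ¬ ContinuousAt (rotOdo π) d}

/-- `D`: the forward and backward orbits of the points of `D₀`. -/
def D (π : Equiv.Perm (Fin q)) : Set UI :=
  {x | ∃ d ∈ D₀ π, ∃ n : ℕ, (rotOdo π)^[n] d = x ∨ (rotOdo π)^[n] x = d}

/-- The underlying set of `I^*`, inside `ℝ × {-, +}` (with `- = false`, `+ = true`): the points
`x⁺ = (x, +)` for `x ∈ I`, the doubles `x⁻ = (x, -)` for `x ∈ D \ {0}`, and the right end
`1 = (1, -)`. A point `x ∈ I` is identified with `x⁺` also when it is not doubled. -/
def starSet (π : Equiv.Perm (Fin q)) : Set (ℝ ×ₗ Bool) :=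
  {p | ((ofLex p).2 = true ∧ (ofLex p).1 ∈ Ico (0 : ℝ) 1) ∨
    ((ofLex p).2 = false ∧
      ((ofLex p).1 = 1 ∨ (ofLex p).1 ∈ ((↑) : UI → ℝ) '' (D π \ {zero})))}

/-- The compactification `I^*`. -/
def IStar (π : Equiv.Perm (Fin q)) : Type := starSet π

/-- `I^*` is ordered lexicographically: by position, and `x⁻ < x⁺`. -/
instance (π : Equiv.Perm (Fin q)) : LinearOrder (IStar π) :=
  inferInstanceAs (LinearOrder (starSet π))

/-- `I^*` carries the order topology. -/
instance (π : Equiv.Perm (Fin q)) : TopologicalSpace (IStar π) := Preorder.topology _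

instance (π : Equiv.Perm (Fin q)) : OrderTopology (IStar π) := ⟨rfl⟩

instance (π : Equiv.Perm (Fin q)) : MeasurableSpace (IStar π) := borel _

instance (π : Equiv.Perm (Fin q)) : BorelSpace (IStar π) := ⟨rfl⟩

/-- The position in `[0,1]` of a point of `I^*`. -/
def IStar.pos {π : Equiv.Perm (Fin q)} (z : IStar π) : ℝ := (ofLex z.1).1

/-- The sign of a point of `I^*`: `true` for `x⁺`, `false` for `x⁻`. -/
def IStar.sign {π : Equiv.Perm (Fin q)} (z : IStar π) : Bool := (ofLex z.1).2

theorem IStar.pos_mem {π : Equiv.Perm (Fin q)} (z : IStar π) (h : z.sign = true) :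
    z.pos ∈ Ico (0 : ℝ) 1 := by
  rcases z.2 with h1 | h1
  · exact h1.2
  · exact absurd (h.symm.trans h1.1) (by decide)

/-- The inclusion `ι : I → I^*`, `x ↦ x⁺`. -/
def incl (π : Equiv.Perm (Fin q)) (x : UI) : IStar π :=
  ⟨toLex ((x : ℝ), true), Or.inl ⟨rfl, x.2⟩⟩

instance (π : Equiv.Perm (Fin q)) : Nonempty (IStar π) := ⟨incl π zero⟩

/-- The extension `F_π^*` of `F_π` to `I^*`: it is `F_π` on `I`, and `F_π^*(x⁻)` is the limit in
`I^*` of `F_π(y)` as `y ∈ I` increases to `x`. At the accumulation point `x̂⁻` of the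
discontinuities this limit is `0`. -/
def starMap (π : Equiv.Perm (Fin q)) (z : IStar π) : IStar π :=
  if h : z.sign = true then incl π (rotOdo π ⟨z.pos, z.pos_mem h⟩)
  else limUnder (comap ((↑) : UI → ℝ) (𝓝[<] z.pos)) (fun y : UI => incl π (rotOdo π y))

/-- `I_per^*`: the union of the sets `[x⁺, y⁻]` with `x ∈ D`, `y ∈ D ∪ {1}`, `x < y` and
`[x, y) ⊆ I_per`. -/
def starPerPart (π : Equiv.Perm (Fin q)) : Set (IStar π) :=
  {z | ∃ (x : UI) (b : IStar π), x ∈ D π ∧ b.sign = false ∧ (x : ℝ) < b.pos ∧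
    (∀ t : UI, x ≤ t → (t : ℝ) < b.pos → t ∈ perPart π) ∧ incl π x ≤ z ∧ z ≤ b}

/-- `I_np^*`, the complement of `I_per^*`. -/
def starNpPart (π : Equiv.Perm (Fin q)) : Set (IStar π) := (starPerPart π)ᶜ

/-- `A` is a non-empty closed subset that `T` maps into itself. -/
def IsSubsystem {X : Type*} [TopologicalSpace X] (T : X → X) (A : Set X) : Prop :=
  A.Nonempty ∧ IsClosed A ∧ MapsTo T A A

/-- `M` is a minimal set of `T` contained in `A`. -/
def IsMinimalIn {X : Type*} [TopologicalSpace X] (T : X → X) (A M : Set X) : Prop :=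
  M ⊆ A ∧ IsSubsystem T M ∧ ∀ M' ⊆ M, IsSubsystem T M' → M' = M

/-- The subsystem `M` has exactly one invariant Borel probability measure. -/
def IsUniquelyErgodicOn {X : Type*} [MeasurableSpace X] (T : X → X) (M : Set X) : Prop :=
  ∃! μ : Measure X, IsProbabilityMeasure μ ∧ μ Mᶜ = 0 ∧ MeasurePreserving T μ μ

end RotatedOdometer

end

/-!
The proof rests on the self-similarity of the von Neumann-Kakutani map `𝔞`: on `[1 - 2⁻ⁿ, 1)` it is
a copy of itself scaled by `2⁻ⁿ` (`kakutani_scale`). Divide `I` into `N = q 2ⁿ` cells of equal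
length. Then `F = F_π` permutes these cells by translations, except that the `q` cells sent into
`[0, 2⁻ⁿ)`, which is the union of the first `q` cells, are also mixed by a scaled copy of `𝔞`
(`exists_isCellPerm`). Two facts follow. A cell consists of periodic points or is carried as a
whole into `[0, 2⁻ⁿ)`, and in the second case every invariant measure gives it the mass of one of
the first `q` cells (`cell_periodic_or_visits`, `cell_periodic_or_measure_eq`). And the first
return map of `F` to `[0, 2⁻ⁿ)` is a scaled copy of `F_π'` for another permutation `π'` of `q`
symbols (`exists_renormalization`).

*Number of ergodic measures.* An invariant measure of `I_np` is determined at each level `n` by the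
masses of `q` cells, and level `n + 1` determines level `n`. So the linear relations that hold, on
the cells of level `n`, between `q + 1` given invariant measures form a decreasing sequence of
nonzero subspaces of `ℝ^(q+1)`, and some nontrivial relation holds at all levels, hence between the
measures (`exists_relation`). Distinct ergodic measures are mutually singular and satisfy none.

*The minimal set.* The map `F^*` is continuous (`continuous_starMap`), because the limit of `F`
from the left at the position of a point `x⁻` is again the position of some `w⁻`, or is `0`,
approached from the right. Every periodic point lies in an interval of periodic points with
endpoints in `D ∪ {1}` (`exists_periodic_interval`), so every point of `I^*_np` lies in `I_np` or is
a limit of points of `I_np` from the left, and its orbit enters every neighbourhood of `0⁺`. Hence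
every subsystem of `I^*_np` contains the orbit closure of `0⁺`, which is therefore the unique minimal
set (`isMinimalIn_minimalSet`, `eq_minimalSet`).

*Unique ergodicity.* `I^*` is compact and metrizable, so an invariant measure exists. The minimal
set has no periodic points, so such a measure has no atoms, does not see the countably many points
`x⁻`, and may be regarded as a measure on `I` (`isAdmissible_map_proj`). Consider a cell of
`[0, 2⁻ⁿ)` visited by the orbit of `0`. By renormalization, and because there are finitely many
permutations of `q` symbols, it contains an iterate of `[0, 2⁻ⁿ⁻ˢ)` with `S` independent of `n`
(`exists_iterate_subset_cell`). So the charged cells of level `n` have comparable masses, with a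
constant independent of `n` and of the measure (`exists_active_cells`), and any two invariant
probability measures are absolutely continuous with respect to each other. Applied to the
restrictions of a measure to an invariant set and to its complement, this shows that each of them
is ergodic; and an ergodic measure is the only invariant probability measure absolutely continuous
with respect to it (`IsAdmissible.unique`).
-/

noncomputable section

/-! ### General facts on invariant measures -/

/-- The absolutely continuous part of `μ` with respect to `ν` is invariant, hence a multiple of both
`μ` and `ν`. -/
theorem Ergodic.mutuallySingular_of_ne {X : Type*} [MeasurableSpace X] {f : X → X}
    {μ ν : Measure X} [IsProbabilityMeasure μ] [IsProbabilityMeasure ν] (hμ : Ergodic f μ)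
    (hν : Ergodic f ν) (hne : μ ≠ ν) : μ.MutuallySingular ν := by
  have hinv := hμ.toMeasurePreserving.withDensity_rnDeriv hν.toMeasurePreserving
  have hle : ν.withDensity (μ.rnDeriv ν) ≤ μ := Measure.withDensity_rnDeriv_le μ ν
  have hfin : IsFiniteMeasure (ν.withDensity (μ.rnDeriv ν)) := isFiniteMeasure_of_le μ hle
  obtain ⟨a, ha⟩ := hμ.eq_smul_of_absolutelyContinuous hinv (Measure.absolutelyContinuous_of_le hle)
  obtain ⟨b, hb⟩ := hν.eq_smul_of_absolutelyContinuous hinv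
    (withDensity_absolutelyContinuous _ _)
  have hab : a = b := by
    have h1 := congrArg (fun ρ : Measure X => ρ univ) (ha.symm.trans hb)
    simpa using h1
  have ha0 : a = 0 := by
    by_contra h0
    refine hne (Measure.ext fun s _ => ?_)
    have hane : a ≠ ⊤ := by
      intro htop
      have h1 := congrArg (fun ρ : Measure X => ρ univ) ha
      simp only [Measure.smul_apply, measure_univ, smul_eq_mul, mul_one] at h1
      exact measure_ne_top (ν.withDensity (μ.rnDeriv ν)) univ (h1.trans htop)
    have h1 := congrArg (fun ρ : Measure X => ρ s) (ha.symm.trans hb)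
    simp only [Measure.smul_apply, smul_eq_mul, hab] at h1
    exact (ENNReal.mul_right_inj (hab ▸ h0) (hab ▸ hane)).1 h1
  rw [ha0, zero_smul] at ha
  have h2 := Measure.rnDeriv_add_singularPart μ ν
  rw [ha, zero_add] at h2
  rw [← h2]
  exact Measure.mutuallySingular_singularPart μ ν

/-- The Krylov-Bogoliubov theorem: a continuous self-map of a non-empty compact metrizable space
has an invariant probability measure. -/
theorem Continuous.exists_measurePreserving {X : Type*} [TopologicalSpace X] [CompactSpace X]
    [TopologicalSpace.MetrizableSpace X] [MeasurableSpace X] [BorelSpace X] [Nonempty X]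
    {T : X → X} (hT : Continuous T) :
    ∃ μ : Measure X, IsProbabilityMeasure μ ∧ MeasurePreserving T μ μ := by
  obtain ⟨x⟩ := ‹Nonempty X›
  set ν : ℕ → Measure X := fun n =>
    ((n + 1 : ℕ) : ENNReal)⁻¹ • ∑ i ∈ Finset.range (n + 1), Measure.dirac (T^[i] x) with hν
  have hprob : ∀ n, IsProbabilityMeasure (ν n) := by
    intro n
    constructor
    simp only [hν, Measure.smul_apply, Measure.finsetSum_apply, measure_univ, Finset.sum_const,
      Finset.card_range, nsmul_eq_mul, mul_one, smul_eq_mul]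
    exact ENNReal.inv_mul_cancel (by simp) (by simp)
  have hint : ∀ n (f : BoundedContinuousFunction X ℝ),
      ∫ y, f y ∂(ν n) = ((n + 1 : ℕ) : ℝ)⁻¹ * ∑ i ∈ Finset.range (n + 1), f (T^[i] x) := by
    intro n f
    simp only [hν]
    rw [integral_smul_measure, integral_finsetSum_measure fun i _ => f.integrable _,
      ENNReal.toReal_inv, ENNReal.toReal_natCast, smul_eq_mul]
    simp only [integral_dirac]
  set P : ℕ → ProbabilityMeasure X := fun n => ⟨ν n, hprob n⟩ with hP
  obtain ⟨μ, -, hμ⟩ := isCompact_iff_ultrafilter_le_nhds'.1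
    (isCompact_univ (X := ProbabilityMeasure X)) ((hyperfilter ℕ).map P) univ_mem
  have hlim := ProbabilityMeasure.tendsto_iff_forall_integral_tendsto.1
    (show Tendsto P (hyperfilter ℕ) (𝓝 μ) from hμ)
  have hinv : ∀ f : BoundedContinuousFunction X ℝ,
      ∫ y, f (T y) ∂(μ : Measure X) = ∫ y, f y ∂(μ : Measure X) := by
    intro f
    set g : BoundedContinuousFunction X ℝ := f.compContinuous ⟨T, hT⟩ with hg
    have hdiff : Tendsto (fun n => ∫ y, g y ∂(ν n) - ∫ y, f y ∂(ν n)) atTop (𝓝 0) := by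
      have he : ∀ n, ∫ y, g y ∂(ν n) - ∫ y, f y ∂(ν n) =
          ((n + 1 : ℕ) : ℝ)⁻¹ * (f (T^[n + 1] x) - f x) := by
        intro n
        rw [hint, hint, ← mul_sub, ← Finset.sum_sub_distrib]
        congr 1
        have h1 := Finset.sum_range_sub (fun i => f (T^[i] x)) (n + 1)
        refine Eq.trans (Finset.sum_congr rfl fun i _ => ?_) h1
        rw [Function.iterate_succ_apply']
        rfl
      simp_rw [he]
      refine (tendsto_natCast_atTop_atTop.comp (tendsto_add_atTop_nat 1)).inv_tendsto_atTop
        |>.zero_mul_isBoundedUnder_le ?_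
      refine isBoundedUnder_of ⟨‖f‖ + ‖f‖, fun n => ?_⟩
      exact (norm_sub_le _ _).trans (add_le_add (f.norm_coe_le_norm _) (f.norm_coe_le_norm _))
    have h1 : Tendsto (fun n => ∫ y, g y ∂(ν n) - ∫ y, f y ∂(ν n)) (hyperfilter ℕ)
        (𝓝 (∫ y, g y ∂(μ : Measure X) - ∫ y, f y ∂(μ : Measure X))) := (hlim g).sub (hlim f)
    have h2 := hdiff.mono_left (Nat.hyperfilter_le_atTop)
    exact sub_eq_zero.1 (tendsto_nhds_unique h1 h2)
  refine ⟨μ, inferInstance, hT.measurable, ?_⟩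
  have : IsProbabilityMeasure (Measure.map T (μ : Measure X)) :=
    Measure.isProbabilityMeasure_map hT.measurable.aemeasurable
  refine ext_of_forall_integral_eq_of_IsFiniteMeasure fun f => ?_
  rw [integral_map hT.measurable.aemeasurable f.continuous.aestronglyMeasurable]
  exact hinv f

namespace RotatedOdometer

/-! ### The von Neumann-Kakutani map and the finite exchange -/

section Kakutani

theorem two_mul_half_pow_le {a b : ℕ} (h : a < b) : 2 * (1 / 2 : ℝ) ^ b ≤ (1 / 2 : ℝ) ^ a := by
  have h1 : (1 / 2 : ℝ) ^ b ≤ (1 / 2 : ℝ) ^ (a + 1) :=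
    pow_le_pow_of_le_one (by norm_num) (by norm_num) h
  rw [pow_succ] at h1
  linarith

theorem index_unique {x : UI} {m : ℕ} (h1 : 1 - 2 * (1 / 2 : ℝ) ^ m ≤ x)
    (h2 : (x : ℝ) < 1 - (1 / 2 : ℝ) ^ m) : index x = m := by
  have h3 := lt_index x
  have h4 := index_le x
  rcases lt_trichotomy (index x) m with h | h | h
  · linarith [two_mul_half_pow_le h]
  · exact h
  · linarith [two_mul_half_pow_le h]

theorem kakutani_coe (x : UI) :
    (kakutani x : ℝ) = (x : ℝ) - (1 - 3 * (1 / 2 : ℝ) ^ (index x)) := rfl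

theorem le_kakutani (x : UI) : (1 / 2 : ℝ) ^ (index x) ≤ kakutani x := by
  rw [kakutani_coe]; linarith [index_le x]

theorem kakutani_lt (x : UI) : (kakutani x : ℝ) < 2 * (1 / 2 : ℝ) ^ (index x) := by
  rw [kakutani_coe]; linarith [lt_index x]

theorem kakutani_pos (x : UI) : 0 < (kakutani x : ℝ) :=
  lt_of_lt_of_le (by positivity) (le_kakutani x)

theorem kakutani_injective : Function.Injective kakutani := by
  intro x y h
  have hxy : index x = index y := by
    have h1 := le_kakutani x
    have h2 := kakutani_lt x
    have h3 := le_kakutani y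
    have h4 := kakutani_lt y
    rw [← h] at h3 h4
    rcases lt_trichotomy (index x) (index y) with hl | hl | hl
    · linarith [two_mul_half_pow_le hl]
    · exact hl
    · linarith [two_mul_half_pow_le hl]
  have h5 : (kakutani x : ℝ) = kakutani y := by rw [h]
  rw [kakutani_coe, kakutani_coe, hxy] at h5
  exact Subtype.ext (by linarith)

theorem exists_kakutani_eq {w : UI} (hw : 0 < (w : ℝ)) : ∃ x, kakutani x = w := by
  classical
  have hex : ∃ n : ℕ, (1 / 2 : ℝ) ^ n ≤ w := by
    obtain ⟨n, hn⟩ := exists_pow_lt_of_lt_one hw (by norm_num : (1 / 2 : ℝ) < 1)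
    exact ⟨n, hn.le⟩
  have h1 := Nat.find_spec hex
  set m := Nat.find hex with hm
  have hm0 : m ≠ 0 := by
    intro h0
    rw [h0, pow_zero] at h1
    linarith [w.2.2]
  obtain ⟨k, hk⟩ := Nat.exists_eq_succ_of_ne_zero hm0
  have h2 : ¬ (1 / 2 : ℝ) ^ k ≤ w := Nat.find_min hex (by omega)
  have h3 : (1 / 2 : ℝ) ^ m = (1 / 2 : ℝ) ^ k / 2 := by rw [hk, pow_succ]; ring
  have h4 : (1 / 2 : ℝ) ^ k ≤ 1 := pow_le_one₀ (by norm_num) (by norm_num)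
  push Not at h2
  have hI : (w : ℝ) + (1 - 3 * (1 / 2 : ℝ) ^ m) ∈ Ico (0 : ℝ) 1 := by
    constructor <;> linarith
  refine ⟨⟨_, hI⟩, ?_⟩
  have hidx : index ⟨_, hI⟩ = m := index_unique (by simp only; linarith) (by simp only; linarith)
  apply Subtype.ext
  rw [kakutani_coe, hidx]
  ring

theorem half_pow_le_one (n : ℕ) : (1 / 2 : ℝ) ^ n ≤ 1 := pow_le_one₀ (by norm_num) (by norm_num)

/-- The contraction `x ↦ 2⁻ⁿ x` of `I` onto `[0, 2⁻ⁿ)`. -/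
def scale (n : ℕ) (x : UI) : UI :=
  ⟨(1 / 2 : ℝ) ^ n * x, mul_nonneg (by positivity) x.2.1, by
    have h1 := half_pow_le_one n
    have h2 : (0 : ℝ) < (1 / 2 : ℝ) ^ n := by positivity
    nlinarith [x.2.1, x.2.2]⟩

theorem scale_coe (n : ℕ) (x : UI) : (scale n x : ℝ) = (1 / 2 : ℝ) ^ n * x := rfl

theorem scale_zero (n : ℕ) : scale n zero = zero := Subtype.ext (by simp [scale_coe, zero])

theorem scale_lt (n : ℕ) (x : UI) : (scale n x : ℝ) < (1 / 2 : ℝ) ^ n := by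
  have h2 : (0 : ℝ) < (1 / 2 : ℝ) ^ n := by positivity
  rw [scale_coe]
  nlinarith [x.2.2]

theorem exists_scale_eq {n : ℕ} {z : UI} (h : (z : ℝ) < (1 / 2 : ℝ) ^ n) : ∃ x, scale n x = z := by
  have h2 : (0 : ℝ) < (1 / 2 : ℝ) ^ n := by positivity
  refine ⟨⟨z / (1 / 2 : ℝ) ^ n, div_nonneg z.2.1 h2.le, (div_lt_one h2).2 h⟩, ?_⟩
  apply Subtype.ext
  rw [scale_coe]
  field_simp

/-- The self-similarity of the von Neumann-Kakutani map: on `[1 - 2⁻ⁿ, 1)` it is a scaled copy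
of itself. -/
theorem kakutani_scale {n : ℕ} {x y : UI}
    (h : (x : ℝ) = 1 - (1 / 2 : ℝ) ^ n + (1 / 2 : ℝ) ^ n * y) :
    kakutani x = scale n (kakutani y) := by
  have h2 : (0 : ℝ) < (1 / 2 : ℝ) ^ n := by positivity
  have h3 := index_le y
  have h4 := lt_index y
  have hidx : index x = n + index y := by
    apply index_unique
    · rw [h, pow_add]; nlinarith
    · rw [h, pow_add]; nlinarith
  apply Subtype.ext
  rw [scale_coe, kakutani_coe, kakutani_coe, hidx, h, pow_add]
  ring

theorem block_eq_iff {q : ℕ} [NeZero q] {x : UI} {k : Fin q} :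
    block q x = k ↔ ((k : ℕ) : ℝ) ≤ q * x ∧ (q : ℝ) * x < ((k : ℕ) : ℝ) + 1 := by
  rw [Fin.ext_iff]
  exact Nat.floor_eq_iff (mul_nonneg (Nat.cast_nonneg _) x.2.1)

theorem block_le {q : ℕ} [NeZero q] (x : UI) : ((block q x : ℕ) : ℝ) ≤ q * x :=
  (block_eq_iff.1 rfl).1

theorem lt_block {q : ℕ} [NeZero q] (x : UI) : (q : ℝ) * x < ((block q x : ℕ) : ℝ) + 1 :=
  (block_eq_iff.1 rfl).2

theorem cast_size_pos (q : ℕ) [NeZero q] : (0 : ℝ) < q :=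
  by exact_mod_cast Nat.pos_of_ne_zero (NeZero.ne q)

variable {q : ℕ} [NeZero q]

theorem exchange_coe (π : Equiv.Perm (Fin q)) (x : UI) : (exchange π x : ℝ) =
    (x : ℝ) + (((π (block q x) : ℕ) : ℝ) - ((block q x : ℕ) : ℝ)) / q := rfl

theorem block_exchange (π : Equiv.Perm (Fin q)) (x : UI) :
    block q (exchange π x) = π (block q x) := by
  have hq := cast_size_pos q
  have e : (q : ℝ) * (exchange π x : ℝ) = q * x + (π (block q x) : ℕ) - (block q x : ℕ) := by
    rw [exchange_coe]; field_simp; ring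
  rw [block_eq_iff, e]
  constructor <;> linarith [block_le (q := q) x, lt_block (q := q) x]

theorem exchange_symm_exchange (π : Equiv.Perm (Fin q)) (x : UI) :
    exchange π⁻¹ (exchange π x) = x := by
  apply Subtype.ext
  rw [exchange_coe, block_exchange, exchange_coe,
    show π⁻¹ (π (block q x)) = block q x from π.symm_apply_apply _]
  ring

theorem exchange_exchange_symm (π : Equiv.Perm (Fin q)) (x : UI) :
    exchange π (exchange π⁻¹ x) = x := by
  simpa using exchange_symm_exchange π⁻¹ x

theorem exchange_injective (π : Equiv.Perm (Fin q)) : Function.Injective (exchange π) :=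
  Function.LeftInverse.injective (exchange_symm_exchange π)

theorem rotOdo_injective (π : Equiv.Perm (Fin q)) : Function.Injective (rotOdo π) :=
  kakutani_injective.comp (exchange_injective π)

theorem rotOdo_pos (π : Equiv.Perm (Fin q)) (x : UI) : 0 < (rotOdo π x : ℝ) := kakutani_pos _

theorem exists_rotOdo_eq (π : Equiv.Perm (Fin q)) {w : UI} (hw : 0 < (w : ℝ)) :
    ∃ x, rotOdo π x = w := by
  obtain ⟨y, rfl⟩ := exists_kakutani_eq hw
  exact ⟨exchange π⁻¹ y, congrArg kakutani (exchange_exchange_symm π y)⟩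

theorem measurable_index : Measurable index := by
  classical
  apply measurable_to_countable'
  intro n
  have : index ⁻¹' {n} =
      {x : UI | 1 - 2 * (1 / 2 : ℝ) ^ n ≤ x ∧ (x : ℝ) < 1 - (1 / 2 : ℝ) ^ n} := by
    ext x
    simp only [mem_preimage, mem_singleton_iff, mem_ofPred_eq]
    refine ⟨?_, fun h => index_unique h.1 h.2⟩
    rintro rfl
    exact ⟨index_le x, lt_index x⟩
  rw [this]
  exact (measurableSet_le measurable_const measurable_subtype_coe).inter
    (measurableSet_lt measurable_subtype_coe measurable_const)

theorem measurable_kakutani : Measurable kakutani := by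
  apply Measurable.subtype_mk
  exact measurable_subtype_coe.sub (measurable_const.sub (measurable_const.mul
    ((measurable_of_countable fun n : ℕ => (1 / 2 : ℝ) ^ n).comp measurable_index)))

theorem measurable_block : Measurable (block q) := by
  apply measurable_to_countable'
  intro k
  have : block q ⁻¹' {k} =
      {x : UI | ((k : ℕ) : ℝ) ≤ q * x ∧ (q : ℝ) * x < ((k : ℕ) : ℝ) + 1} := by
    ext x
    exact block_eq_iff
  rw [this]
  exact (measurableSet_le measurable_const (measurable_subtype_coe.const_mul _)).inter
    (measurableSet_lt (measurable_subtype_coe.const_mul _) measurable_const)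

theorem measurable_exchange (π : Equiv.Perm (Fin q)) : Measurable (exchange π) := by
  apply Measurable.subtype_mk
  exact measurable_subtype_coe.add ((measurable_of_countable fun k : Fin q =>
    (((π k : ℕ) : ℝ) - ((k : ℕ) : ℝ)) / q).comp measurable_block)

theorem measurable_rotOdo (π : Equiv.Perm (Fin q)) : Measurable (rotOdo π) :=
  measurable_kakutani.comp (measurable_exchange π)

theorem measurableSet_perPart (π : Equiv.Perm (Fin q)) : MeasurableSet (perPart π) := by
  have : perPart π = ⋃ n : ℕ, {x | 0 < n ∧ (rotOdo π)^[n] x = x} := by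
    ext x
    simp [perPart, Function.periodicPts, Function.IsPeriodicPt, Function.IsFixedPt]
  rw [this]
  refine MeasurableSet.iUnion fun n => (MeasurableSet.const _).inter ?_
  exact measurableSet_eq_fun ((measurable_rotOdo π).iterate n) measurable_id

theorem zero_notMem_perPart (π : Equiv.Perm (Fin q)) : zero ∉ perPart π := by
  rintro ⟨n, hn, h⟩
  obtain ⟨m, rfl⟩ := Nat.exists_eq_succ_of_ne_zero hn.ne'
  have h1 : (rotOdo π)^[m + 1] zero = zero := h
  rw [Function.iterate_succ_apply'] at h1
  have := rotOdo_pos π ((rotOdo π)^[m] zero)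
  rw [h1] at this
  exact absurd this (lt_irrefl (0 : ℝ))

theorem mem_perPart_of_iterate (π : Equiv.Perm (Fin q)) {k : ℕ} {x : UI}
    (h : (rotOdo π)^[k] x ∈ perPart π) : x ∈ perPart π := by
  obtain ⟨n, hn, h⟩ := h
  refine ⟨n, hn, (rotOdo_injective π).iterate k ?_⟩
  have h1 : (rotOdo π)^[n] ((rotOdo π)^[k] x) = (rotOdo π)^[k] x := h
  rw [← Function.iterate_add_apply, add_comm, Function.iterate_add_apply] at h1
  exact h1

end Kakutani

/-! ### Grid cells and the permutation of cells at level `n` -/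

section Cells

variable {q : ℕ} [NeZero q]

theorem block_shift {N : ℕ} [NeZero N] {x y : UI} {d : ℤ} (h : (y : ℝ) = x + d / N) :
    ((block N y : ℕ) : ℤ) = (block N x : ℕ) + d := by
  have hN := cast_size_pos N
  have h1 : (N : ℝ) * y = N * x + d := by rw [h]; field_simp
  have a1 := block_le (q := N) x
  have a2 := lt_block (q := N) x
  have a3 := block_le (q := N) y
  have a4 := lt_block (q := N) y
  have b1 : (((block N y : ℕ) : ℤ) : ℝ) < (((block N x : ℕ) + d + 1 : ℤ) : ℝ) := by
    push_cast; linarith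
  have b2 : (((block N x : ℕ) + d : ℤ) : ℝ) < (((block N y : ℕ) + 1 : ℤ) : ℝ) := by
    push_cast; linarith
  have c1 := Int.cast_lt.1 b1
  have c2 := Int.cast_lt.1 b2
  omega

theorem block_eq_block_of_mul (n : ℕ) {x x' : UI}
    (h : block (q * 2 ^ n) x = block (q * 2 ^ n) x') : block q x = block q x' := by
  have key : ∀ z : UI, (block q z : ℕ) = (block (q * 2 ^ n) z : ℕ) / 2 ^ n := by
    intro z
    change ⌊(q : ℝ) * z⌋₊ = ⌊((q * 2 ^ n : ℕ) : ℝ) * z⌋₊ / 2 ^ n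
    rw [← Nat.floor_div_natCast]
    congr 1
    push_cast
    field_simp
  apply Fin.ext
  rw [key, key, h]

theorem dyadic_le_iff {n m : ℕ} (hm : m ≤ n) {x x' : UI}
    (h : block (q * 2 ^ n) x = block (q * 2 ^ n) x') :
    1 - (1 / 2 : ℝ) ^ m ≤ x ↔ 1 - (1 / 2 : ℝ) ^ m ≤ x' := by
  have hN := cast_size_pos (q * 2 ^ n)
  have hle : 2 ^ (n - m) ≤ 2 ^ n := Nat.pow_le_pow_right (by norm_num) (by omega)
  have e : 1 - (1 / 2 : ℝ) ^ m = ((q * (2 ^ n - 2 ^ (n - m)) : ℕ) : ℝ) / ((q * 2 ^ n : ℕ) : ℝ) := by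
    have hq := cast_size_pos q
    obtain ⟨k, rfl⟩ := Nat.exists_eq_add_of_le hm
    push_cast [Nat.cast_sub hle]
    rw [Nat.add_sub_cancel_left, pow_add, div_pow, one_pow]
    field_simp
  have key : ∀ z : UI, 1 - (1 / 2 : ℝ) ^ m ≤ z ↔
      q * (2 ^ n - 2 ^ (n - m)) ≤ (block (q * 2 ^ n) z : ℕ) := by
    intro z
    rw [e, div_le_iff₀ hN, mul_comm (z : ℝ)]
    exact (Nat.le_floor_iff (mul_nonneg hN.le z.2.1)).symm
  rw [key, key, h]

theorem index_le_of_lt {n : ℕ} {x : UI} (h : (x : ℝ) < 1 - (1 / 2 : ℝ) ^ n) : index x ≤ n := by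
  by_contra hc
  push Not at hc
  linarith [two_mul_half_pow_le hc, index_le x]

theorem index_eq_of_block {n : ℕ} {x x' : UI} (h : block (q * 2 ^ n) x = block (q * 2 ^ n) x')
    (hx : (x : ℝ) < 1 - (1 / 2 : ℝ) ^ n) : index x' = index x := by
  have h1 := index_le_of_lt hx
  obtain ⟨m, hm⟩ := Nat.exists_eq_succ_of_ne_zero (Nat.one_le_iff_ne_zero.1 (index_pos x))
  have h2 := index_le x
  have h3 := lt_index x
  have e : 1 - 2 * (1 / 2 : ℝ) ^ (index x) = 1 - (1 / 2 : ℝ) ^ m := by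
    rw [hm, pow_succ]; ring
  apply index_unique
  · rw [e] at h2 ⊢
    exact (dyadic_le_iff (by omega) h).1 h2
  · exact lt_of_not_ge fun hc => absurd ((dyadic_le_iff h1 h).2 hc) (not_le.2 h3)

open Classical in
/-- The cyclic permutation of the dyadic intervals of length `2⁻ⁿ` that agrees with the von
Neumann-Kakutani map below `1 - 2⁻ⁿ`. -/
def dyadicCycle (n : ℕ) (x : UI) : UI :=
  if h : (x : ℝ) < 1 - (1 / 2 : ℝ) ^ n then kakutani x else
    ⟨(x : ℝ) - (1 - (1 / 2 : ℝ) ^ n), by linarith, by linarith [half_pow_le_one n, x.2.2]⟩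

theorem dyadicCycle_of_lt {n : ℕ} {x : UI} (h : (x : ℝ) < 1 - (1 / 2 : ℝ) ^ n) :
    dyadicCycle n x = kakutani x := by
  rw [dyadicCycle, dif_pos h]

theorem dyadicCycle_of_le {n : ℕ} {x : UI} (h : 1 - (1 / 2 : ℝ) ^ n ≤ x) :
    (dyadicCycle n x : ℝ) = (x : ℝ) - (1 - (1 / 2 : ℝ) ^ n) := by
  rw [dyadicCycle, dif_neg (not_lt.2 h)]

theorem dyadicCycle_lt_iff {n : ℕ} {x : UI} :
    (dyadicCycle n x : ℝ) < (1 / 2 : ℝ) ^ n ↔ 1 - (1 / 2 : ℝ) ^ n ≤ x := by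
  constructor
  · intro h
    by_contra hc
    push Not at hc
    rw [dyadicCycle_of_lt hc] at h
    have h1 := le_kakutani x
    have h2 : (1 / 2 : ℝ) ^ n ≤ (1 / 2 : ℝ) ^ (index x) :=
      pow_le_pow_of_le_one (by norm_num) (by norm_num) (index_le_of_lt hc)
    linarith
  · intro h
    rw [dyadicCycle_of_le h]
    linarith [x.2.2]

theorem dyadicCycle_injective (n : ℕ) : Function.Injective (dyadicCycle n) := by
  intro x y h
  have hiff : 1 - (1 / 2 : ℝ) ^ n ≤ x ↔ 1 - (1 / 2 : ℝ) ^ n ≤ y := by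
    rw [← dyadicCycle_lt_iff, ← dyadicCycle_lt_iff, h]
  by_cases hx : 1 - (1 / 2 : ℝ) ^ n ≤ x
  · have h1 : (dyadicCycle n x : ℝ) = dyadicCycle n y := by rw [h]
    rw [dyadicCycle_of_le hx, dyadicCycle_of_le (hiff.1 hx)] at h1
    exact Subtype.ext (by linarith)
  · have hy : ¬ 1 - (1 / 2 : ℝ) ^ n ≤ y := fun hy => hx (hiff.2 hy)
    rw [dyadicCycle_of_lt (not_le.1 hx), dyadicCycle_of_lt (not_le.1 hy)] at h
    exact kakutani_injective h

/-- On each cell of level `n`, the map `dyadicCycle n` is a translation by a multiple of the cell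
length. -/
theorem exists_dyadicCycle_shift (n : ℕ) (x : UI) : ∃ d : ℤ, ∀ x' : UI,
    block (q * 2 ^ n) x = block (q * 2 ^ n) x' →
      (dyadicCycle n x' : ℝ) = x' + d / ((q * 2 ^ n : ℕ) : ℝ) := by
  have hq := cast_size_pos q
  by_cases hx : (x : ℝ) < 1 - (1 / 2 : ℝ) ^ n
  · have hi := index_le_of_lt hx
    refine ⟨-(q * (2 ^ n - 3 * 2 ^ (n - index x))), fun x' h => ?_⟩
    have hx' : (x' : ℝ) < 1 - (1 / 2 : ℝ) ^ n :=
      lt_of_not_ge fun hc => absurd ((dyadic_le_iff le_rfl h).2 hc) (not_le.2 hx)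
    rw [dyadicCycle_of_lt hx', kakutani_coe, index_eq_of_block h hx]
    obtain ⟨k, hk⟩ := Nat.exists_eq_add_of_le hi
    rw [hk, Nat.add_sub_cancel_left]
    push_cast
    rw [pow_add, div_pow, one_pow]
    field_simp
    ring
  · refine ⟨-(q * (2 ^ n - 1)), fun x' h => ?_⟩
    rw [dyadicCycle_of_le ((dyadic_le_iff le_rfl h).1 (not_lt.1 hx))]
    push_cast
    rw [div_pow, one_pow]
    field_simp
    ring

theorem exists_shift (π : Equiv.Perm (Fin q)) (n : ℕ) (x : UI) : ∃ d : ℤ, ∀ x' : UI,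
    block (q * 2 ^ n) x = block (q * 2 ^ n) x' →
      (dyadicCycle n (exchange π x') : ℝ) = x' + d / ((q * 2 ^ n : ℕ) : ℝ) := by
  have hq := cast_size_pos q
  obtain ⟨d, hd⟩ := exists_dyadicCycle_shift (q := q) n (exchange π x)
  set e : ℤ := 2 ^ n * (((π (block q x) : ℕ) : ℤ) - ((block q x : ℕ) : ℤ)) with he
  have hE : ∀ x' : UI, block (q * 2 ^ n) x = block (q * 2 ^ n) x' →
      (exchange π x' : ℝ) = x' + e / ((q * 2 ^ n : ℕ) : ℝ) := by
    intro x' h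
    rw [exchange_coe, ← block_eq_block_of_mul n h, he]
    push_cast
    field_simp
  refine ⟨d + e, fun x' h => ?_⟩
  have hb : block (q * 2 ^ n) (exchange π x) = block (q * 2 ^ n) (exchange π x') := by
    have h1 := block_shift (hE x rfl)
    have h2 := block_shift (hE x' h)
    rw [← h] at h2
    exact Fin.ext (by omega)
  rw [hd _ hb, hE x' h]
  push_cast
  ring

/-- The left endpoint `k/N` of a cell. -/
def leftEnd (N : ℕ) [NeZero N] (k : Fin N) : UI :=
  ⟨(k : ℕ) / (N : ℝ), by
    have hN := cast_size_pos N
    have hk : ((k : ℕ) : ℝ) < N := by exact_mod_cast k.2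
    exact ⟨by positivity, (div_lt_one hN).2 hk⟩⟩

theorem block_leftEnd {N : ℕ} [NeZero N] (k : Fin N) : block N (leftEnd N k) = k := by
  have hN := cast_size_pos N
  have e : (N : ℝ) * (leftEnd N k : ℝ) = (k : ℕ) := by
    change (N : ℝ) * ((k : ℕ) / (N : ℝ)) = _
    field_simp
  rw [block_eq_iff, e]
  constructor <;> linarith

theorem exists_perm_dyadicCycle (π : Equiv.Perm (Fin q)) (n : ℕ) :
    ∃ σ : Equiv.Perm (Fin (q * 2 ^ n)), ∀ x : UI,
      (dyadicCycle n (exchange π x) : ℝ) = x +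
        (((σ (block (q * 2 ^ n) x) : ℕ) : ℝ) - (block (q * 2 ^ n) x : ℕ)) /
          ((q * 2 ^ n : ℕ) : ℝ) := by
  set s : Fin (q * 2 ^ n) → Fin (q * 2 ^ n) := fun k =>
    block (q * 2 ^ n) (dyadicCycle n (exchange π (leftEnd (q * 2 ^ n) k))) with hs
  have hx : ∀ x : UI, (dyadicCycle n (exchange π x) : ℝ) = x +
        (((s (block (q * 2 ^ n) x) : ℕ) : ℝ) - (block (q * 2 ^ n) x : ℕ)) /
          ((q * 2 ^ n : ℕ) : ℝ) := by
    intro x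
    obtain ⟨d, hd⟩ := exists_shift π n x
    have h1 := block_shift (hd (leftEnd _ (block (q * 2 ^ n) x)) (block_leftEnd _).symm)
    rw [block_leftEnd] at h1
    have h2 : (d : ℝ) = ((s (block (q * 2 ^ n) x) : ℕ) : ℝ) - (block (q * 2 ^ n) x : ℕ) := by
      have h3 : d = ((s (block (q * 2 ^ n) x) : ℕ) : ℤ) - (block (q * 2 ^ n) x : ℕ) := by
        change ((s (block (q * 2 ^ n) x) : ℕ) : ℤ) = _ at h1
        omega
      rw [h3]
      push_cast
      rfl
    rw [hd x rfl, h2]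
  have hinj : Function.Injective s := by
    intro k l hkl
    have hk := hx (leftEnd _ k)
    have hl := hx (leftEnd _ l)
    rw [block_leftEnd] at hk hl
    have e : ∀ k : Fin (q * 2 ^ n), (leftEnd (q * 2 ^ n) k : ℝ) =
        (k : ℕ) / ((q * 2 ^ n : ℕ) : ℝ) := fun k => rfl
    have h1 : dyadicCycle n (exchange π (leftEnd _ k)) =
        dyadicCycle n (exchange π (leftEnd _ l)) := by
      apply Subtype.ext
      rw [hk, hl, hkl, e, e]
      ring
    have h2 := congrArg (block (q * 2 ^ n)) (exchange_injective π (dyadicCycle_injective n h1))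
    rwa [block_leftEnd, block_leftEnd] at h2
  exact ⟨Equiv.ofBijective s (Finite.injective_iff_bijective.1 hinj), hx⟩

theorem lt_half_pow_iff {n : ℕ} {x : UI} :
    (x : ℝ) < (1 / 2 : ℝ) ^ n ↔ (block (q * 2 ^ n) x : ℕ) < q := by
  have hN := cast_size_pos (q * 2 ^ n)
  have hq := cast_size_pos q
  have h1 := block_le (q := q * 2 ^ n) x
  have h2 := lt_block (q := q * 2 ^ n) x
  have e : (1 / 2 : ℝ) ^ n = q / ((q * 2 ^ n : ℕ) : ℝ) := by
    push_cast; rw [div_pow, one_pow]; field_simp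
  rw [e, lt_div_iff₀ hN, mul_comm]
  constructor
  · intro h
    exact_mod_cast h1.trans_lt h
  · intro h
    have : ((block (q * 2 ^ n) x : ℕ) : ℝ) + 1 ≤ q := by exact_mod_cast h
    linarith

/-- `σ` describes `F_π` at level `n`: a cell whose image under `σ` is not one of the first `q`
cells is translated onto that image, and a cell sent to one of the first `q` cells, which make up
`[0, 2⁻ⁿ)`, is first translated onto it and then moved by a scaled copy of the von
Neumann-Kakutani map. -/
def IsCellPerm (π : Equiv.Perm (Fin q)) (n : ℕ) (σ : Equiv.Perm (Fin (q * 2 ^ n))) : Prop :=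
  (∀ x : UI, q ≤ (σ (block (q * 2 ^ n) x) : ℕ) → (rotOdo π x : ℝ) = x +
      (((σ (block (q * 2 ^ n) x) : ℕ) : ℝ) - (block (q * 2 ^ n) x : ℕ)) / ((q * 2 ^ n : ℕ) : ℝ)) ∧
  ∀ x : UI, (σ (block (q * 2 ^ n) x) : ℕ) < q → ∃ y : UI, (scale n y : ℝ) = x +
      (((σ (block (q * 2 ^ n) x) : ℕ) : ℝ) - (block (q * 2 ^ n) x : ℕ)) / ((q * 2 ^ n : ℕ) : ℝ) ∧
      rotOdo π x = scale n (kakutani y)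

theorem exists_isCellPerm (π : Equiv.Perm (Fin q)) (n : ℕ) : ∃ σ, IsCellPerm π n σ := by
  obtain ⟨σ, hσ⟩ := exists_perm_dyadicCycle π n
  have hb : ∀ x, block (q * 2 ^ n) (dyadicCycle n (exchange π x)) = σ (block (q * 2 ^ n) x) := by
    intro x
    have h1 : (dyadicCycle n (exchange π x) : ℝ) = x +
        (((σ (block (q * 2 ^ n) x) : ℕ) - (block (q * 2 ^ n) x : ℕ) : ℤ) : ℝ) /
          ((q * 2 ^ n : ℕ) : ℝ) := by
      rw [hσ]; push_cast; rfl
    have := block_shift h1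
    exact Fin.ext (by omega)
  refine ⟨σ, fun x hx => ?_, fun x hx => ?_⟩
  · rw [← hσ]
    rw [← hb, ← not_lt, ← lt_half_pow_iff, dyadicCycle_lt_iff, not_le] at hx
    rw [dyadicCycle_of_lt hx]
    rfl
  · rw [← hb, ← lt_half_pow_iff] at hx
    obtain ⟨y, hy⟩ := exists_scale_eq hx
    refine ⟨y, by rw [hy, hσ], ?_⟩
    apply kakutani_scale
    rw [dyadicCycle_lt_iff] at hx
    have h1 := dyadicCycle_of_le hx
    rw [← hy, scale_coe] at h1
    linarith

end Cells

/-! ### Dynamics of cells and renormalization -/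

section CellDynamics

variable {q : ℕ} [NeZero q] {π : Equiv.Perm (Fin q)} {n : ℕ} {σ : Equiv.Perm (Fin (q * 2 ^ n))}

theorem IsCellPerm.lt_half_pow (hσ : IsCellPerm π n σ) {x : UI}
    (hx : (σ (block (q * 2 ^ n) x) : ℕ) < q) : (rotOdo π x : ℝ) < (1 / 2 : ℝ) ^ n := by
  obtain ⟨y, -, hy⟩ := hσ.2 x hx
  rw [hy]
  exact scale_lt n _

theorem IsCellPerm.block_rotOdo (hσ : IsCellPerm π n σ) {x : UI}
    (hx : q ≤ (σ (block (q * 2 ^ n) x) : ℕ)) :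
    block (q * 2 ^ n) (rotOdo π x) = σ (block (q * 2 ^ n) x) := by
  have h1 : (rotOdo π x : ℝ) = x +
      (((σ (block (q * 2 ^ n) x) : ℕ) - (block (q * 2 ^ n) x : ℕ) : ℤ) : ℝ) /
        ((q * 2 ^ n : ℕ) : ℝ) := by
    rw [hσ.1 x hx]; push_cast; rfl
  have := block_shift h1
  exact Fin.ext (by omega)

theorem IsCellPerm.iterate (hσ : IsCellPerm π n σ) {x : UI} (m : ℕ)
    (hx : ∀ j, 1 ≤ j → j ≤ m → q ≤ ((σ ^ j) (block (q * 2 ^ n) x) : ℕ)) :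
    ((rotOdo π)^[m] x : ℝ) = x + ((((σ ^ m) (block (q * 2 ^ n) x) : ℕ) : ℝ) -
      (block (q * 2 ^ n) x : ℕ)) / ((q * 2 ^ n : ℕ) : ℝ) ∧
    block (q * 2 ^ n) ((rotOdo π)^[m] x) = (σ ^ m) (block (q * 2 ^ n) x) := by
  induction m with
  | zero => simp
  | succ m ih =>
    obtain ⟨h1, h2⟩ := ih fun j hj hjm => hx j hj (by omega)
    have h3 := hx (m + 1) (by omega) le_rfl
    rw [pow_succ', Equiv.Perm.mul_apply, ← h2] at h3
    rw [Function.iterate_succ_apply', pow_succ', Equiv.Perm.mul_apply, ← h2,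
      hσ.block_rotOdo h3, hσ.1 _ h3, h1, h2]
    exact ⟨by ring, rfl⟩

theorem IsCellPerm.mem_perPart (hσ : IsCellPerm π n σ) {x : UI}
    (hx : ∀ j, q ≤ ((σ ^ j) (block (q * 2 ^ n) x) : ℕ)) : x ∈ perPart π := by
  refine ⟨orderOf σ, orderOf_pos σ, ?_⟩
  have h := (hσ.iterate (orderOf σ) fun j _ _ => hx j).1
  rw [pow_orderOf_eq_one, Equiv.Perm.one_apply, sub_self, zero_div, add_zero] at h
  exact Subtype.ext h

/-- A cell either consists of periodic points, or is carried as a whole into `[0, 2⁻ⁿ)`. -/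
theorem cell_periodic_or_visits (π : Equiv.Perm (Fin q)) (n : ℕ) (k : Fin (q * 2 ^ n)) :
    (∀ x, block (q * 2 ^ n) x = k → x ∈ perPart π) ∨
      ∃ j, ∀ x, block (q * 2 ^ n) x = k → ((rotOdo π)^[j] x : ℝ) < (1 / 2 : ℝ) ^ n := by
  classical
  obtain ⟨σ, hσ⟩ := exists_isCellPerm π n
  by_cases h : ∃ j, ((σ ^ j) k : ℕ) < q
  · right
    have h1 := Nat.find_spec h
    have h2 : ∀ j < Nat.find h, ¬ ((σ ^ j) k : ℕ) < q := fun j hj => Nat.find_min h hj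
    refine ⟨Nat.find h, ?_⟩
    rintro x rfl
    set j := Nat.find h
    rcases Nat.eq_zero_or_pos j with h0 | h0
    · rw [h0] at h1 ⊢
      exact lt_half_pow_iff.2 h1
    · obtain ⟨m, hm⟩ := Nat.exists_eq_succ_of_ne_zero h0.ne'
      have h3 := (hσ.iterate m fun i _ him => not_lt.1 (h2 i (by omega))).2
      rw [hm, Nat.succ_eq_add_one, pow_succ', Equiv.Perm.mul_apply, ← h3] at h1
      rw [hm, Nat.succ_eq_add_one, Function.iterate_succ_apply']
      exact hσ.lt_half_pow h1
  · left
    push Not at h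
    rintro x rfl
    exact hσ.mem_perPart h

/-- The cell `[k/N, (k+1)/N)` as a set of points of `I`. -/
def cell (N : ℕ) [NeZero N] (k : Fin N) : Set UI := {x | block N x = k}

theorem measurableSet_cell {N : ℕ} [NeZero N] (k : Fin N) : MeasurableSet (cell N k) :=
  measurable_block (measurableSet_singleton k)

theorem IsCellPerm.preimage_cell (hσ : IsCellPerm π n σ) {k : Fin (q * 2 ^ n)}
    (hk : q ≤ (σ k : ℕ)) : rotOdo π ⁻¹' cell (q * 2 ^ n) (σ k) = cell (q * 2 ^ n) k := by
  ext x
  simp only [cell, mem_preimage, mem_ofPred_eq]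
  by_cases hx : (σ (block (q * 2 ^ n) x) : ℕ) < q
  · have h1 := hσ.lt_half_pow hx
    rw [lt_half_pow_iff (q := q)] at h1
    constructor
    · intro h
      rw [h] at h1
      omega
    · rintro rfl
      omega
  · rw [hσ.block_rotOdo (not_lt.1 hx)]
    exact σ.injective.eq_iff

theorem IsCellPerm.measure_cell (hσ : IsCellPerm π n σ) {μ : Measure UI}
    (hμ : MeasurePreserving (rotOdo π) μ μ) {i : Fin (q * 2 ^ n)} (m : ℕ)
    (hi : ∀ j, 1 ≤ j → j ≤ m → q ≤ ((σ ^ j) i : ℕ)) :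
    μ (cell (q * 2 ^ n) ((σ ^ m) i)) = μ (cell (q * 2 ^ n) i) := by
  induction m with
  | zero => simp
  | succ m ih =>
    have h3 := hi (m + 1) (by omega) le_rfl
    rw [← ih fun j hj hjm => hi j hj (by omega)]
    rw [pow_succ', Equiv.Perm.mul_apply] at h3 ⊢
    rw [← hμ.measure_preimage (measurableSet_cell _).nullMeasurableSet, hσ.preimage_cell h3]

/-- A cell either consists of periodic points, or has, for every invariant measure, the same
measure as one of the first `q` cells. -/
theorem cell_periodic_or_measure_eq (π : Equiv.Perm (Fin q)) (n : ℕ) (k : Fin (q * 2 ^ n)) :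
    (cell (q * 2 ^ n) k ⊆ perPart π) ∨
      ∃ i : Fin (q * 2 ^ n), (i : ℕ) < q ∧ ∀ μ : Measure UI, MeasurePreserving (rotOdo π) μ μ →
        μ (cell (q * 2 ^ n) k) = μ (cell (q * 2 ^ n) i) := by
  classical
  obtain ⟨σ, hσ⟩ := exists_isCellPerm π n
  by_cases h : ∃ j, ((σ⁻¹ ^ j) k : ℕ) < q
  · right
    have h1 := Nat.find_spec h
    have h2 : ∀ j < Nat.find h, ¬ ((σ⁻¹ ^ j) k : ℕ) < q := fun j hj => Nat.find_min h hj
    set j := Nat.find h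
    have key : ∀ l ≤ j, (σ ^ l) ((σ⁻¹ ^ j) k) = (σ⁻¹ ^ (j - l)) k := by
      intro l hl
      obtain ⟨m, hm⟩ := Nat.exists_eq_add_of_le hl
      rw [hm, Nat.add_sub_cancel_left, ← Equiv.Perm.mul_apply, pow_add, inv_pow, inv_pow,
        mul_inv_cancel_left]
    refine ⟨(σ⁻¹ ^ j) k, h1, fun μ hμ => ?_⟩
    rw [← hσ.measure_cell hμ (i := (σ⁻¹ ^ j) k) j, key j le_rfl, Nat.sub_self]
    · rfl
    · intro l hl hlj
      rw [key l hlj]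
      exact not_lt.1 (h2 _ (by omega))
  · left
    push Not at h
    rintro x rfl
    apply hσ.mem_perPart
    intro j
    -- a positive power of `σ` is also a power of `σ⁻¹`, as `σ` has finite order
    have e : σ ^ j = σ⁻¹ ^ (orderOf σ * j - j) := by
      have hle : j ≤ orderOf σ * j := Nat.le_mul_of_pos_left _ (orderOf_pos σ)
      rw [inv_pow, eq_inv_iff_mul_eq_one, ← pow_add, Nat.add_sub_cancel' hle, pow_mul,
        pow_orderOf_eq_one, one_pow]
    rw [e]
    exact h _

theorem cell_translated_or_lt (π : Equiv.Perm (Fin q)) (n : ℕ) (k : Fin (q * 2 ^ n)) :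
    (∃ c : ℝ, ∀ x, block (q * 2 ^ n) x = k → (rotOdo π x : ℝ) = x + c) ∨
      ∀ x, block (q * 2 ^ n) x = k → (rotOdo π x : ℝ) < (1 / 2 : ℝ) ^ n := by
  obtain ⟨σ, hσ⟩ := exists_isCellPerm π n
  by_cases h : (σ k : ℕ) < q
  · right
    rintro x rfl
    exact hσ.lt_half_pow h
  · left
    refine ⟨(((σ k : ℕ) : ℝ) - (k : ℕ)) / ((q * 2 ^ n : ℕ) : ℝ), ?_⟩
    rintro x rfl
    exact hσ.1 x (not_lt.1 h)

theorem block_scale {n : ℕ} (x : UI) : (block (q * 2 ^ n) (scale n x) : ℕ) = block q x := by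
  change ⌊((q * 2 ^ n : ℕ) : ℝ) * (scale n x : ℝ)⌋₊ = ⌊(q : ℝ) * x⌋₊
  congr 1
  rw [scale_coe]
  push_cast
  rw [div_pow, one_pow]
  field_simp

/-- Renormalization: the first return map of `F_π` to `[0, 2⁻ⁿ)` is a scaled copy of a rotated
odometer `F_π'` on the same number of symbols. The return time `τ` is constant on each of the `q`
cells of `[0, 2⁻ⁿ)`. -/
theorem exists_renormalization (π : Equiv.Perm (Fin q)) (n : ℕ) :
    ∃ (π' : Equiv.Perm (Fin q)) (τ : Fin q → ℕ), (∀ i, 1 ≤ τ i) ∧ ∀ x : UI,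
      (rotOdo π)^[τ (block q x)] (scale n x) = scale n (rotOdo π' x) ∧
      ∀ k, 1 ≤ k → k < τ (block q x) → (1 / 2 : ℝ) ^ n ≤ (rotOdo π)^[k] (scale n x) := by
  classical
  obtain ⟨σ, hσ⟩ := exists_isCellPerm π n
  have hqN : q ≤ q * 2 ^ n := Nat.le_mul_of_pos_right _ (by positivity)
  have hex : ∀ i : Fin q, ∃ m, 1 ≤ m ∧ ((σ ^ m) (Fin.castLE hqN i) : ℕ) < q := fun i =>
    ⟨orderOf σ, orderOf_pos σ, by rw [pow_orderOf_eq_one]; exact i.2⟩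
  set τ : Fin q → ℕ := fun i => Nat.find (hex i) with hτ
  have hτ1 : ∀ i, 1 ≤ τ i := fun i => (Nat.find_spec (hex i)).1
  have hτ2 : ∀ i, ((σ ^ τ i) (Fin.castLE hqN i) : ℕ) < q := fun i => (Nat.find_spec (hex i)).2
  have hτ3 : ∀ i m, 1 ≤ m → m < τ i → q ≤ ((σ ^ m) (Fin.castLE hqN i) : ℕ) := by
    intro i m hm hlt
    have := Nat.find_min (hex i) hlt
    by_contra hc
    exact this ⟨hm, not_le.1 hc⟩
  set f : Fin q → Fin q := fun i => ⟨(σ ^ τ i) (Fin.castLE hqN i), hτ2 i⟩ with hf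
  have hlt : ∀ i j, f i = f j → τ i < τ j → False := by
    intro i j hij hl
    have h1 : (σ ^ τ i) (Fin.castLE hqN i) = (σ ^ τ j) (Fin.castLE hqN j) :=
      Fin.ext (congrArg (fun z : Fin q => (z : ℕ)) hij :)
    obtain ⟨d, hd⟩ := Nat.exists_eq_add_of_le hl.le
    rw [hd, pow_add, Equiv.Perm.mul_apply] at h1
    have h2 := (σ ^ τ i).injective h1
    have h3 := hτ3 j d (by omega) (by have := hτ1 i; omega)
    rw [← h2] at h3
    exact absurd i.2 (not_lt.2 h3)
  have hinj : Function.Injective f := by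
    intro i j hij
    rcases lt_trichotomy (τ i) (τ j) with h | h | h
    · exact (hlt i j hij h).elim
    · have h1 : (σ ^ τ i) (Fin.castLE hqN i) = (σ ^ τ j) (Fin.castLE hqN j) :=
        Fin.ext (congrArg (fun z : Fin q => (z : ℕ)) hij :)
      rw [h] at h1
      exact Fin.castLE_injective hqN ((σ ^ τ j).injective h1)
    · exact (hlt j i hij.symm h).elim
  refine ⟨Equiv.ofBijective f (Finite.injective_iff_bijective.1 hinj), τ, hτ1, fun x => ?_⟩
  set i := block q x with hi
  have hb : block (q * 2 ^ n) (scale n x) = Fin.castLE hqN i := Fin.ext (block_scale x)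
  have hit : ∀ m < τ i, _ := fun m hm => hσ.iterate (x := scale n x) m
    fun j hj hjm => by rw [hb]; exact hτ3 i j hj (by omega)
  constructor
  · obtain ⟨m, hm⟩ := Nat.exists_eq_succ_of_ne_zero (Nat.one_le_iff_ne_zero.1 (hτ1 i))
    obtain ⟨h1, h2⟩ := hit m (by omega)
    have h3 := hτ2 i
    rw [hm, Nat.succ_eq_add_one, pow_succ', Equiv.Perm.mul_apply, ← hb, ← h2] at h3
    obtain ⟨y, hy1, hy2⟩ := hσ.2 _ h3
    rw [hm, Nat.succ_eq_add_one, Function.iterate_succ_apply', hy2]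
    have hy : y = exchange (Equiv.ofBijective f (Finite.injective_iff_bijective.1 hinj)) x := by
      apply Subtype.ext
      have e1 : σ (block (q * 2 ^ n) ((rotOdo π)^[m] (scale n x))) =
          (σ ^ τ i) (Fin.castLE hqN i) := by
        rw [h2, hb, hm, Nat.succ_eq_add_one, pow_succ', Equiv.Perm.mul_apply]
      have e2 : ((f i : ℕ) : ℝ) = (((σ ^ τ i) (Fin.castLE hqN i) : ℕ) : ℝ) := rfl
      rw [e1, ← e2, h1, h2, hb, scale_coe, scale_coe] at hy1
      have hq := cast_size_pos q
      rw [exchange_coe, ← hi]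
      have e3 : ((Fin.castLE hqN i : ℕ) : ℝ) = ((i : ℕ) : ℝ) := rfl
      rw [e3] at hy1
      push_cast at hy1
      rw [div_pow, one_pow] at hy1
      field_simp at hy1
      rw [Equiv.ofBijective_apply]
      field_simp
      linarith
    rw [hy]
    rfl
  · intro k hk hkτ
    rw [← not_lt, lt_half_pow_iff (q := q), not_lt, (hit k hkτ).2, hb]
    exact hτ3 i k hk hkτ

end CellDynamics

/-! ### One-sided germs of `F_π` -/

section Germs

variable {q : ℕ} [NeZero q]

theorem exists_half_pow_lt {η : ℝ} (hη : 0 < η) : ∃ n : ℕ, (1 / 2 : ℝ) ^ n < η :=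
  exists_pow_lt_of_lt_one hη (by norm_num)

theorem exists_right_cell (N : ℕ) [NeZero N] (x : UI) :
    ∃ ε > 0, ∀ t : UI, x ≤ t → (t : ℝ) < x + ε → block N t = block N x := by
  have hN := cast_size_pos N
  refine ⟨((block N x : ℕ) + 1) / N - x, ?_, fun t hxt ht => ?_⟩
  · rw [gt_iff_lt, sub_pos, lt_div_iff₀ hN, mul_comm]
    exact lt_block x
  · have h1 : (x : ℝ) ≤ t := hxt
    have h2 : (t : ℝ) < ((block N x : ℕ) + 1) / N := by linarith
    rw [lt_div_iff₀ hN, mul_comm] at h2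
    rw [block_eq_iff]
    exact ⟨(block_le x).trans (by gcongr), h2⟩

theorem exists_left_cell (N : ℕ) [NeZero N] {b : ℝ} (h0 : 0 < b) (h1 : b ≤ 1) :
    ∃ k : Fin N, ∃ ε > 0, ∀ t : UI, b - ε < t → (t : ℝ) < b → block N t = k := by
  have hN := cast_size_pos N
  have hpos : 0 < ⌈(N : ℝ) * b⌉₊ := Nat.ceil_pos.2 (by positivity)
  have hle : ⌈(N : ℝ) * b⌉₊ ≤ N := Nat.ceil_le.2 (by nlinarith)
  obtain ⟨k, hk⟩ := Nat.exists_eq_succ_of_ne_zero hpos.ne'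
  have h2 : (k : ℝ) < N * b := Nat.lt_ceil.1 (by omega)
  have h3 : (N : ℝ) * b ≤ k + 1 := by
    have := Nat.le_ceil ((N : ℝ) * b)
    rw [hk] at this
    exact_mod_cast this
  refine ⟨⟨k, by omega⟩, b - k / N, ?_, fun t ht1 ht2 => ?_⟩
  · rw [gt_iff_lt, sub_pos, div_lt_iff₀ hN, mul_comm]
    exact h2
  · have h4 : (k : ℝ) / N < t := by linarith
    rw [div_lt_iff₀ hN, mul_comm] at h4
    rw [block_eq_iff]
    exact ⟨h4.le, by nlinarith⟩

theorem right_germ (π : Equiv.Perm (Fin q)) (x : UI) :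
    ∃ ε > 0, ∀ t : UI, x ≤ t → (t : ℝ) < x + ε → (rotOdo π t : ℝ) = rotOdo π x + (t - x) := by
  obtain ⟨n, hn⟩ := exists_half_pow_lt (rotOdo_pos π x)
  obtain ⟨ε, hε, h⟩ := exists_right_cell (q * 2 ^ n) x
  refine ⟨ε, hε, fun t h1 h2 => ?_⟩
  rcases cell_translated_or_lt π n (block (q * 2 ^ n) x) with ⟨c, hc⟩ | hc
  · rw [hc t (h t h1 h2), hc x rfl]; ring
  · exact absurd (hc x rfl) (not_lt.2 hn.le)

/-- On the left of a point of `(0, 1]`, the map `F_π` is a translation, or tends to `0`. -/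
theorem left_germ (π : Equiv.Perm (Fin q)) {b : ℝ} (h0 : 0 < b) (h1 : b ≤ 1) :
    (∃ ε > 0, ∃ c : ℝ, ∀ t : UI, b - ε < t → (t : ℝ) < b → (rotOdo π t : ℝ) = t + c) ∨
      ∀ η > 0, ∃ ε > 0, ∀ t : UI, b - ε < t → (t : ℝ) < b → (rotOdo π t : ℝ) < η := by
  by_contra! hc
  obtain ⟨hc1, η, hη, hc2⟩ := hc
  obtain ⟨n, hn⟩ := exists_half_pow_lt hη
  obtain ⟨k, ε, hε, h⟩ := exists_left_cell (q * 2 ^ n) h0 h1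
  rcases cell_translated_or_lt π n k with ⟨c, hk⟩ | hk
  · obtain ⟨t, h2, h3, h4⟩ := hc1 ε hε c
    exact h4 (hk t (h t h2 h3))
  · obtain ⟨t, h2, h3, h4⟩ := hc2 ε hε
    linarith [hk t (h t h2 h3)]

theorem exists_mem_left {b ε : ℝ} (h0 : 0 < b) (h1 : b ≤ 1) (hε : 0 < ε) :
    ∃ t : UI, b - ε < t ∧ (t : ℝ) < b := by
  refine ⟨⟨max (b / 2) (b - ε / 2), ?_, ?_⟩, ?_, ?_⟩
  · exact le_max_of_le_left (by linarith)
  · exact max_lt (by linarith) (by linarith)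
  · exact lt_max_of_lt_right (by linarith)
  · exact max_lt (by linarith) (by linarith)

theorem pos_of_ne_zero {x : UI} (h : x ≠ zero) : 0 < (x : ℝ) :=
  lt_of_le_of_ne x.2.1 fun h0 => h (Subtype.ext h0.symm)

theorem local_translation (π : Equiv.Perm (Fin q)) {x : UI} (hx : x ∉ D₀ π) :
    ∃ ε > 0, ∀ t : UI, |(t : ℝ) - x| < ε → (rotOdo π t : ℝ) = rotOdo π x + (t - x) := by
  have hx0 : 0 < (x : ℝ) := pos_of_ne_zero fun h => hx (Or.inl h)
  have hcont : ContinuousAt (rotOdo π) x := by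
    by_contra h
    exact hx (Or.inr (Or.inr h))
  have hcont' : ∀ η > 0, ∃ δ > 0, ∀ t : UI, |(t : ℝ) - x| < δ →
      |(rotOdo π t : ℝ) - rotOdo π x| < η := by
    intro η hη
    obtain ⟨δ, hδ, h⟩ := Metric.continuousAt_iff.1 hcont η hη
    exact ⟨δ, hδ, fun t ht => h (x := t) (by rwa [Subtype.dist_eq, Real.dist_eq])⟩
  obtain ⟨ε₁, hε₁, h₁⟩ := right_germ π x
  rcases left_germ π hx0 x.2.2.le with ⟨ε₂, hε₂, c, h₂⟩ | h₂
  · have hc : (x : ℝ) + c = rotOdo π x := by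
      by_contra hne
      have hη : 0 < |(x : ℝ) + c - rotOdo π x| / 2 := half_pos (abs_pos.2 (sub_ne_zero.2 hne))
      set η := |(x : ℝ) + c - rotOdo π x| / 2 with hηd
      obtain ⟨δ, hδ, h⟩ := hcont' η hη
      obtain ⟨t, ht1, ht2⟩ := exists_mem_left hx0 x.2.2.le (lt_min (lt_min hε₂ hδ) hη)
      have e1 := min_le_left (min ε₂ δ) η
      have e2 := min_le_right (min ε₂ δ) η
      have e3 := min_le_left ε₂ δ
      have e4 := min_le_right ε₂ δ
      have h3 := h t (by rw [abs_lt]; constructor <;> linarith)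
      rw [h₂ t (by linarith) ht2, abs_lt] at h3
      have h5 : |(x : ℝ) + c - rotOdo π x| < 2 * η := by
        rw [abs_lt]
        constructor <;> linarith [h3.1, h3.2]
      linarith
    refine ⟨min ε₁ ε₂, lt_min hε₁ hε₂, fun t ht => ?_⟩
    have e1 := min_le_left ε₁ ε₂
    have e2 := min_le_right ε₁ ε₂
    rw [abs_lt] at ht
    rcases le_or_gt (x : ℝ) t with h | h
    · exact h₁ t h (by linarith)
    · rw [h₂ t (by linarith) h]; linarith
  · exfalso
    have hF := rotOdo_pos π x
    obtain ⟨ε, hε, h⟩ := h₂ (rotOdo π x / 2) (half_pos hF)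
    obtain ⟨δ, hδ, h'⟩ := hcont' (rotOdo π x / 2) (half_pos hF)
    obtain ⟨t, ht1, ht2⟩ := exists_mem_left hx0 x.2.2.le (lt_min hε hδ)
    have e1 := min_le_left ε δ
    have e2 := min_le_right ε δ
    have h3 := h t (by linarith) ht2
    have h4 := h' t (by rw [abs_lt]; constructor <;> linarith)
    rw [abs_lt] at h4
    linarith

/-! ### The set `D` of doubled points -/

theorem D₀_subset_D (π : Equiv.Perm (Fin q)) : D₀ π ⊆ D π :=
  fun x hx => ⟨x, hx, 0, Or.inl rfl⟩

theorem zero_mem_D (π : Equiv.Perm (Fin q)) : zero ∈ D π := D₀_subset_D π (Or.inl rfl)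

theorem rotOdo_mem_D_iff {π : Equiv.Perm (Fin q)} {x : UI} : rotOdo π x ∈ D π ↔ x ∈ D π := by
  constructor
  · rintro ⟨d, hd, n, h | h⟩
    · cases n with
      | zero => exact ⟨d, hd, 1, Or.inr h.symm⟩
      | succ n =>
        rw [Function.iterate_succ_apply'] at h
        exact ⟨d, hd, n, Or.inl (rotOdo_injective π h)⟩
    · exact ⟨d, hd, n + 1, Or.inr h⟩
  · rintro ⟨d, hd, n, h | h⟩
    · refine ⟨d, hd, n + 1, Or.inl ?_⟩
      rw [Function.iterate_succ_apply', h]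
    · cases n with
      | zero => exact ⟨d, hd, 1, Or.inl (congrArg _ (Eq.symm h))⟩
      | succ n => exact ⟨d, hd, n, Or.inr h⟩

theorem iterate_mem_D_iff {π : Equiv.Perm (Fin q)} {x : UI} (j : ℕ) :
    (rotOdo π)^[j] x ∈ D π ↔ x ∈ D π := by
  induction j with
  | zero => rfl
  | succ j ih => rw [Function.iterate_succ_apply', rotOdo_mem_D_iff, ih]

theorem continuousAt_rotOdo (π : Equiv.Perm (Fin q)) {x : UI}
    (hx : ∀ n, leftEnd (q * 2 ^ n) (block (q * 2 ^ n) x) ≠ x) : ContinuousAt (rotOdo π) x := by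
  obtain ⟨n, hn⟩ := exists_half_pow_lt (rotOdo_pos π x)
  have hN := cast_size_pos (q * 2 ^ n)
  have h1 : ((block (q * 2 ^ n) x : ℕ) : ℝ) < (q * 2 ^ n : ℕ) * (x : ℝ) := by
    refine lt_of_le_of_ne (block_le x) fun h => hx n (Subtype.ext ?_)
    change ((block (q * 2 ^ n) x : ℕ) : ℝ) / ((q * 2 ^ n : ℕ) : ℝ) = x
    rw [h]
    field_simp
  have h2 := lt_block (q := q * 2 ^ n) x
  rcases cell_translated_or_lt π n (block (q * 2 ^ n) x) with ⟨c, hc⟩ | hc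
  · have hopen : ∀ᶠ t : UI in 𝓝 x, block (q * 2 ^ n) t = block (q * 2 ^ n) x := by
      have hcont : Continuous fun t : UI => ((q * 2 ^ n : ℕ) : ℝ) * t := by fun_prop
      filter_upwards [hcont.continuousAt.eventually (lt_mem_nhds h1),
        hcont.continuousAt.eventually (gt_mem_nhds h2)] with t h3 h4
      exact block_eq_iff.2 ⟨h3.le, h4⟩
    rw [Topology.IsInducing.subtypeVal.continuousAt_iff]
    have h3 : ContinuousAt (fun t : UI => (t : ℝ) + c) x := by fun_prop
    refine h3.congr ?_
    filter_upwards [hopen] with t ht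
    exact (hc t ht).symm
  · exact absurd (hc x rfl) (not_lt.2 hn.le)

theorem countable_D₀ (π : Equiv.Perm (Fin q)) : (D₀ π).Countable := by
  have hsub : D₀ π ⊆ {zero} ∪ ((fun d : UI => (exchange π d : ℝ)) ⁻¹'
      range (fun n : ℕ => 1 - (1 / 2 : ℝ) ^ n)) ∪ ⋃ n, range (leftEnd (q * 2 ^ n)) := by
    rintro d (h | ⟨n, h⟩ | h)
    · exact Or.inl (Or.inl h)
    · exact Or.inl (Or.inr ⟨n, h.symm⟩)
    · right
      by_contra hc
      refine h (continuousAt_rotOdo π fun n hn => hc ?_)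
      exact mem_iUnion.2 ⟨n, _, hn⟩
  refine Countable.mono hsub (((countable_singleton _).union ?_).union ?_)
  · exact (countable_range _).preimage_of_injOn
      (Subtype.val_injective.comp (exchange_injective π)).injOn
  · exact countable_iUnion fun n => countable_range _

theorem countable_D (π : Equiv.Perm (Fin q)) : (D π).Countable := by
  have hsub : D π ⊆ ⋃ n : ℕ, ((rotOdo π)^[n] '' D₀ π ∪ (rotOdo π)^[n] ⁻¹' D₀ π) := by
    rintro x ⟨d, hd, n, h | h⟩
    · exact mem_iUnion.2 ⟨n, Or.inl ⟨d, hd, h⟩⟩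
    · exact mem_iUnion.2 ⟨n, Or.inr (by rw [mem_preimage, h]; exact hd)⟩
  refine Countable.mono hsub (countable_iUnion fun n => ?_)
  exact ((countable_D₀ π).image _).union
    ((countable_D₀ π).preimage_of_injOn ((rotOdo_injective π).iterate n).injOn)

/-! ### Periodic points lie in intervals of periodic points with endpoints in `D` -/

theorem right_germ_iterate (π : Equiv.Perm (Fin q)) (x : UI) (p : ℕ) :
    ∃ ε > 0, ∀ t : UI, x ≤ t → (t : ℝ) < x + ε → ∀ j ≤ p,
      ((rotOdo π)^[j] t : ℝ) = (rotOdo π)^[j] x + (t - x) := by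
  induction p with
  | zero =>
    refine ⟨1, one_pos, fun t _ _ j hj => ?_⟩
    obtain rfl : j = 0 := by omega
    simp
  | succ p ih =>
    obtain ⟨ε₁, h₁, ih⟩ := ih
    obtain ⟨ε₂, h₂, h⟩ := right_germ π ((rotOdo π)^[p] x)
    refine ⟨min ε₁ ε₂, lt_min h₁ h₂, fun t hxt ht j hj => ?_⟩
    have e1 := min_le_left ε₁ ε₂
    have e2 := min_le_right ε₁ ε₂
    have h3 := ih t hxt (by linarith)
    rcases Nat.lt_or_ge j (p + 1) with hlt | hge
    · exact h3 j (by omega)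
    · obtain rfl : j = p + 1 := by omega
      have h4 := h3 p le_rfl
      have hxt' : (x : ℝ) ≤ t := hxt
      rw [Function.iterate_succ_apply', Function.iterate_succ_apply', h _ _ (by linarith), h4]
      · ring
      · exact Subtype.coe_le_coe.1 (by linarith)

theorem local_translation_iterate (π : Equiv.Perm (Fin q)) {x : UI} (hx : x ∉ D π) (p : ℕ) :
    ∃ ε > 0, ∀ t : UI, |(t : ℝ) - x| < ε → ∀ j ≤ p,
      ((rotOdo π)^[j] t : ℝ) = (rotOdo π)^[j] x + (t - x) := by
  induction p with
  | zero =>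
    refine ⟨1, one_pos, fun t _ j hj => ?_⟩
    obtain rfl : j = 0 := by omega
    simp
  | succ p ih =>
    obtain ⟨ε₁, h₁, ih⟩ := ih
    obtain ⟨ε₂, h₂, h⟩ := local_translation π (x := (rotOdo π)^[p] x)
      fun hc => hx ((iterate_mem_D_iff p).1 (D₀_subset_D π hc))
    refine ⟨min ε₁ ε₂, lt_min h₁ h₂, fun t ht j hj => ?_⟩
    have h3 := ih t (ht.trans_le (min_le_left _ _))
    rcases Nat.lt_or_ge j (p + 1) with hlt | hge
    · exact h3 j (by omega)
    · obtain rfl : j = p + 1 := by omega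
      have h4 := h3 p le_rfl
      rw [Function.iterate_succ_apply', Function.iterate_succ_apply', h, h4]
      · ring
      · rw [h4]
        simpa using ht.trans_le (min_le_right _ _)

/-- The maximal interval around `x` on which the first `p` iterates of `F_π` are the same
translations as at `x` starts at a point of `D`: outside `D` the iterates are
translations on both sides. -/
theorem exists_left_end_mem_D (π : Equiv.Perm (Fin q)) (x : UI) (p : ℕ) :
    ∃ l ∈ D π, l ≤ x ∧ ∀ t : UI, l ≤ t → t ≤ x → ∀ j ≤ p,
      ((rotOdo π)^[j] t : ℝ) = (rotOdo π)^[j] x + (t - x) := by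
  set S : Set ℝ := {s | 0 ≤ s ∧ s ≤ x ∧ ∀ t : UI, s ≤ t → t ≤ x → ∀ j ≤ p,
    ((rotOdo π)^[j] t : ℝ) = (rotOdo π)^[j] x + (t - x)} with hS
  have hxS : (x : ℝ) ∈ S := by
    refine ⟨x.2.1, le_rfl, fun t h1 h2 j _ => ?_⟩
    obtain rfl : t = x := le_antisymm h2 h1
    simp
  have hbdd : BddBelow S := ⟨0, fun s hs => hs.1⟩
  have hl0 : 0 ≤ sInf S := le_csInf ⟨_, hxS⟩ fun s hs => hs.1
  have hlx : sInf S ≤ x := csInf_le hbdd hxS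
  have hgt : ∀ t : UI, sInf S < t → t ≤ x → ∀ j ≤ p,
      ((rotOdo π)^[j] t : ℝ) = (rotOdo π)^[j] x + (t - x) := by
    intro t h1 h2
    obtain ⟨s, hs, hst⟩ := exists_lt_of_csInf_lt ⟨_, hxS⟩ h1
    exact hs.2.2 t hst.le h2
  set l : UI := ⟨sInf S, hl0, hlx.trans_lt x.2.2⟩ with hl
  have hlc : (l : ℝ) = sInf S := rfl
  have hself : ∀ j ≤ p, ((rotOdo π)^[j] l : ℝ) = (rotOdo π)^[j] x + (l - x) := by
    intro j hj
    rcases hlx.eq_or_lt with h | h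
    · have : l = x := Subtype.ext h
      rw [this]; simp
    · obtain ⟨ε, hε, hr⟩ := right_germ_iterate π l p
      have hm : 0 < min ε (x - sInf S) := lt_min hε (by linarith)
      have e1 := min_le_left ε ((x : ℝ) - sInf S)
      have e2 := min_le_right ε ((x : ℝ) - sInf S)
      set t : UI := ⟨sInf S + min ε (x - sInf S) / 2, by linarith, by linarith [x.2.2]⟩ with ht
      have htc : (t : ℝ) = sInf S + min ε (x - sInf S) / 2 := rfl
      have h1 := hgt t (by linarith) (Subtype.coe_le_coe.1 (by linarith)) j hj
      have h2 := hr t (Subtype.coe_le_coe.1 (by linarith)) (by linarith) j hj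
      linarith
  refine ⟨l, ?_, hlx, fun t h1 h2 => ?_⟩
  · by_contra hD
    obtain ⟨ε, hε, h⟩ := local_translation_iterate π hD p
    have hlpos : 0 < (l : ℝ) := pos_of_ne_zero fun h0 => hD (h0 ▸ zero_mem_D π)
    have hmem : max 0 ((l : ℝ) - ε / 2) ∈ S := by
      refine ⟨le_max_left _ _, max_le x.2.1 (by linarith), fun t h1 h2 j hj => ?_⟩
      rcases lt_trichotomy (t : ℝ) l with hlt | heq | hgt'
      · have h3 := le_max_right 0 ((l : ℝ) - ε / 2)
        rw [h t (by rw [abs_lt]; constructor <;> linarith) j hj, hself j hj]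
        ring
      · rw [Subtype.ext heq]
        exact hself j hj
      · exact hgt t hgt' h2 j hj
    have h3 := csInf_le hbdd hmem
    have h4 : max 0 ((l : ℝ) - ε / 2) < l := max_lt hlpos (by linarith)
    linarith
  · rcases (Subtype.coe_le_coe.2 h1).eq_or_lt with h | h
    · rw [← Subtype.ext h]
      exact hself
    · exact hgt t h h2

/-- The maximal interval around `x` on which the first `p` iterates of `F_π` are the same
translations as at `x` ends at a point of `D` or at `1`. -/
theorem exists_right_end_mem_D (π : Equiv.Perm (Fin q)) (x : UI) (p : ℕ) :
    ∃ y : ℝ, (x : ℝ) < y ∧ (y = 1 ∨ y ∈ ((↑) : UI → ℝ) '' (D π \ {zero})) ∧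
      ∀ t : UI, x ≤ t → (t : ℝ) < y → ∀ j ≤ p,
        ((rotOdo π)^[j] t : ℝ) = (rotOdo π)^[j] x + (t - x) := by
  set S : Set ℝ := {s | s ≤ 1 ∧ ∀ t : UI, x ≤ t → (t : ℝ) < s → ∀ j ≤ p,
    ((rotOdo π)^[j] t : ℝ) = (rotOdo π)^[j] x + (t - x)} with hS
  obtain ⟨ε₀, hε₀, h₀⟩ := right_germ_iterate π x p
  have hxS : min 1 ((x : ℝ) + ε₀) ∈ S :=
    ⟨min_le_left _ _, fun t h1 h2 => h₀ t h1 (h2.trans_le (min_le_right _ _))⟩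
  have hbdd : BddAbove S := ⟨1, fun s hs => hs.1⟩
  have hy1 : sSup S ≤ 1 := csSup_le ⟨_, hxS⟩ fun s hs => hs.1
  have hxy : (x : ℝ) < sSup S :=
    (lt_min x.2.2 (by linarith)).trans_le (le_csSup hbdd hxS)
  have hlt : ∀ t : UI, x ≤ t → (t : ℝ) < sSup S → ∀ j ≤ p,
      ((rotOdo π)^[j] t : ℝ) = (rotOdo π)^[j] x + (t - x) := by
    intro t h1 h2
    obtain ⟨s, hs, hst⟩ := exists_lt_of_lt_csSup ⟨_, hxS⟩ h2
    exact hs.2 t h1 hst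
  refine ⟨sSup S, hxy, ?_, hlt⟩
  rcases hy1.eq_or_lt with h | h
  · exact Or.inl h
  right
  set y : UI := ⟨sSup S, x.2.1.trans hxy.le, h⟩ with hy
  have hyc : (y : ℝ) = sSup S := rfl
  refine ⟨y, ⟨?_, ?_⟩, rfl⟩
  · by_contra hD
    obtain ⟨ε, hε, h⟩ := local_translation_iterate π hD p
    have hself : ∀ j ≤ p, ((rotOdo π)^[j] y : ℝ) = (rotOdo π)^[j] x + (y - x) := by
      intro j hj
      have hm : 0 < min ε (sSup S - x) := lt_min hε (by linarith)
      have e1 := min_le_left ε (sSup S - x)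
      have e2 := min_le_right ε (sSup S - x)
      set t : UI := ⟨sSup S - min ε (sSup S - x) / 2, by linarith [x.2.1], by linarith⟩ with ht
      have htc : (t : ℝ) = sSup S - min ε (sSup S - x) / 2 := rfl
      have h1 := hlt t (Subtype.coe_le_coe.1 (by linarith)) (by linarith) j hj
      have h2 := h t (by rw [abs_lt]; constructor <;> linarith) j hj
      linarith
    have hmem : min 1 ((y : ℝ) + ε) ∈ S := by
      refine ⟨min_le_left _ _, fun t h1 h2 j hj => ?_⟩
      have h3 := min_le_right 1 ((y : ℝ) + ε)
      rcases lt_or_ge (t : ℝ) y with hlt' | hge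
      · exact hlt t h1 hlt' j hj
      · rw [h t (by rw [abs_lt]; constructor <;> linarith) j hj, hself j hj]
        ring
    have h3 := le_csSup hbdd hmem
    have h4 : (y : ℝ) < min 1 ((y : ℝ) + ε) := lt_min y.2.2 (by linarith)
    linarith
  · intro h0
    have h0' : (y : ℝ) = 0 := by rw [show y = zero from h0]; rfl
    linarith [x.2.1]

theorem exists_periodic_interval {π : Equiv.Perm (Fin q)} {x : UI} (hx : x ∈ perPart π) :
    ∃ l ∈ D π, l ≤ x ∧ ∃ y : ℝ, (x : ℝ) < y ∧
      (y = 1 ∨ y ∈ ((↑) : UI → ℝ) '' (D π \ {zero})) ∧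
      ∀ t : UI, l ≤ t → (t : ℝ) < y → t ∈ perPart π := by
  obtain ⟨p, hp, h⟩ := hx
  have hpx : (rotOdo π)^[p] x = x := h
  obtain ⟨l, hl, hlx, h1⟩ := exists_left_end_mem_D π x p
  obtain ⟨y, hxy, hy, h2⟩ := exists_right_end_mem_D π x p
  refine ⟨l, hl, hlx, y, hxy, hy, fun t hlt hty => ⟨p, hp, Subtype.ext ?_⟩⟩
  rcases le_total t x with h3 | h3
  · rw [h1 t hlt h3 p le_rfl, hpx]; ring
  · rw [h2 t h3 hty p le_rfl, hpx]; ring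

end Germs

/-! ### Order and topology of the compactification -/

section Compactification

variable {q : ℕ} [NeZero q] {π : Equiv.Perm (Fin q)}

/-- The condition on a position `b` for the point `b⁻` to belong to `I^*`. -/
def IsMinusPos (π : Equiv.Perm (Fin q)) (b : ℝ) : Prop :=
  b = 1 ∨ b ∈ ((↑) : UI → ℝ) '' (D π \ {zero})

theorem IsMinusPos.pos {b : ℝ} (hb : IsMinusPos π b) : 0 < b := by
  rcases hb with rfl | ⟨x, hx, rfl⟩
  · exact one_pos
  · exact pos_of_ne_zero hx.2

theorem IsMinusPos.le_one {b : ℝ} (hb : IsMinusPos π b) : b ≤ 1 := by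
  rcases hb with rfl | ⟨x, -, rfl⟩
  · exact le_rfl
  · exact x.2.2.le

/-- The point `b⁻` of `I^*`. -/
def minus {b : ℝ} (hb : IsMinusPos π b) : IStar π := ⟨toLex (b, false), Or.inr ⟨rfl, hb⟩⟩

namespace IStar

theorem lt_iff {z w : IStar π} :
    z < w ↔ z.pos < w.pos ∨ z.pos = w.pos ∧ z.sign = false ∧ w.sign = true := by
  rw [← Bool.lt_iff]
  exact Prod.Lex.lt_iff

theorem exists_eq (z : IStar π) :
    (∃ x, z = incl π x) ∨ ∃ b, ∃ hb : IsMinusPos π b, z = minus hb := by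
  obtain ⟨⟨b, s⟩, h⟩ := z
  rcases h with ⟨h1, h2⟩ | ⟨h1, h2⟩
  · left
    exact ⟨⟨b, h2⟩, Subtype.ext (congrArg toLex (Prod.ext rfl h1))⟩
  · right
    exact ⟨b, h2, Subtype.ext (congrArg toLex (Prod.ext rfl h1))⟩

end IStar

theorem incl_pos (x : UI) : (incl π x).pos = x := rfl
theorem incl_sign (x : UI) : (incl π x).sign = true := rfl
theorem minus_pos {b : ℝ} (hb : IsMinusPos π b) : (minus hb).pos = b := rfl
theorem minus_sign {b : ℝ} (hb : IsMinusPos π b) : (minus hb).sign = false := rfl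

theorem incl_lt_iff {x : UI} {z : IStar π} : incl π x < z ↔ (x : ℝ) < z.pos := by
  rw [IStar.lt_iff, incl_sign, incl_pos]
  simp

theorem lt_minus_iff {b : ℝ} {hb : IsMinusPos π b} {z : IStar π} : z < minus hb ↔ z.pos < b := by
  rw [IStar.lt_iff, minus_sign, minus_pos]
  simp

theorem incl_le_incl {x y : UI} : incl π x ≤ incl π y ↔ x ≤ y := by
  rw [← not_lt, incl_lt_iff, incl_pos, ← Subtype.coe_le_coe, not_lt]

theorem incl_injective : Function.Injective (incl π) := by
  intro x y h
  exact Subtype.ext (congrArg IStar.pos h)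

theorem minus_le_iff {b : ℝ} {hb : IsMinusPos π b} {z : IStar π} : minus hb ≤ z ↔ b ≤ z.pos := by
  rw [← not_lt, lt_minus_iff, not_lt]

theorem le_incl_iff {x : UI} {z : IStar π} : z ≤ incl π x ↔ z.pos ≤ x := by
  rw [← not_lt, incl_lt_iff, not_lt]

theorem incl_le_minus {x : UI} {b : ℝ} {hb : IsMinusPos π b} :
    incl π x ≤ minus hb ↔ (x : ℝ) < b := by
  have e : (x : ℝ) < b ↔ incl π x < minus hb :=
    (incl_lt_iff (π := π) (x := x) (z := minus hb)).symm
  rw [e]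
  refine ⟨fun h => lt_of_le_of_ne h fun he => ?_, le_of_lt⟩
  have := congrArg IStar.sign he
  rw [incl_sign, minus_sign] at this
  exact absurd this (by decide)

/-- The point `x⁻` is the immediate predecessor of `x⁺`. -/
theorem lt_incl_iff_le_minus {x : UI} {hx : IsMinusPos π x} {z : IStar π} :
    z < incl π x ↔ z ≤ minus hx := by
  rw [IStar.lt_iff, ← not_lt, IStar.lt_iff, incl_pos, incl_sign, minus_pos, minus_sign]
  rcases lt_trichotomy z.pos x with h | h | h
  · simp [h, h.not_gt, h.ne']
  · simp [h]
  · simp [h, h.not_gt, h.ne']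

theorem IStar.pos_nonneg (z : IStar π) : 0 ≤ z.pos := by
  rcases z.exists_eq with ⟨x, rfl⟩ | ⟨b, hb, rfl⟩
  · exact x.2.1
  · exact hb.pos.le

theorem IStar.pos_le_one (z : IStar π) : z.pos ≤ 1 := by
  rcases z.exists_eq with ⟨x, rfl⟩ | ⟨b, hb, rfl⟩
  · exact x.2.2.le
  · exact hb.le_one

theorem incl_zero_le (z : IStar π) : incl π zero ≤ z := by
  rcases z.exists_eq with ⟨x, rfl⟩ | ⟨b, hb, rfl⟩
  · exact incl_le_incl.2 x.2.1
  · exact incl_le_minus.2 hb.pos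

theorem isMinusPos_of_mem_D {x : UI} (hx : x ∈ D π) (h0 : x ≠ zero) : IsMinusPos π x :=
  Or.inr ⟨x, ⟨hx, h0⟩, rfl⟩

theorem exists_mem_of_lt {r s : ℝ} (hr : 0 ≤ r) (hrs : r < s) (hs : s ≤ 1) :
    ∃ t : UI, r < t ∧ (t : ℝ) < s :=
  ⟨⟨(r + s) / 2, by linarith, by linarith⟩, by simp only; linarith, by simp only; linarith⟩

theorem continuous_pos : Continuous (IStar.pos : IStar π → ℝ) := by
  rw [continuous_iff_continuousAt]
  intro z
  refine tendsto_order.2 ⟨fun a ha => ?_, fun a ha => ?_⟩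
  · rcases lt_or_ge a 0 with h | h
    · exact Eventually.of_forall fun w => h.trans_le w.pos_nonneg
    · have h1 : incl π ⟨a, h, ha.trans_le z.pos_le_one⟩ < z := incl_lt_iff.2 ha
      filter_upwards [lt_mem_nhds h1] with w hw
      exact incl_lt_iff.1 hw
  · rcases lt_or_ge 1 a with h | h
    · exact Eventually.of_forall fun w => w.pos_le_one.trans_lt h
    · obtain ⟨t, ht1, ht2⟩ := exists_mem_of_lt z.pos_nonneg ha h
      have h1 : z < incl π t := IStar.lt_iff.2 (Or.inl ht1)
      filter_upwards [gt_mem_nhds h1] with w hw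
      exact (le_incl_iff.1 hw.le).trans_lt ht2

/-- Points of `I` that decrease to `y` converge to `y⁺` in `I^*`. -/
theorem tendsto_incl_right (y : UI) :
    Tendsto (incl π) (comap ((↑) : UI → ℝ) (𝓝[≥] (y : ℝ))) (𝓝 (incl π y)) := by
  refine tendsto_order.2 ⟨fun a ha => ?_, fun a ha => ?_⟩
  · have h : ∀ᶠ s : ℝ in 𝓝[≥] (y : ℝ), (y : ℝ) ≤ s := eventually_mem_nhdsWithin
    filter_upwards [h.comap _] with t ht
    exact ha.trans_le (incl_le_incl.2 ht)
  · have h : ∀ᶠ s : ℝ in 𝓝[≥] (y : ℝ), s < a.pos :=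
      nhdsWithin_le_nhds (gt_mem_nhds (incl_lt_iff.1 ha))
    filter_upwards [h.comap _] with t ht
    exact incl_lt_iff.2 ht

/-- Points of `I` that increase to `b` converge to `b⁻` in `I^*`. -/
theorem tendsto_incl_left {b : ℝ} (hb : IsMinusPos π b) :
    Tendsto (incl π) (comap ((↑) : UI → ℝ) (𝓝[<] b)) (𝓝 (minus hb)) := by
  refine tendsto_order.2 ⟨fun a ha => ?_, fun a ha => ?_⟩
  · have h : ∀ᶠ s : ℝ in 𝓝[<] b, a.pos < s :=
      nhdsWithin_le_nhds (lt_mem_nhds (lt_minus_iff.1 ha))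
    filter_upwards [h.comap _] with t ht
    exact IStar.lt_iff.2 (Or.inl ht)
  · have h : ∀ᶠ s : ℝ in 𝓝[<] b, s < b := eventually_mem_nhdsWithin
    filter_upwards [h.comap _] with t ht
    exact (incl_le_minus.2 ht).trans_lt ha

theorem continuousAt_incl {y : UI} (hy : y ∉ D π) : ContinuousAt (incl π) y := by
  refine tendsto_order.2 ⟨fun a ha => ?_, fun a ha => ?_⟩
  · have h1 : a.pos < y := by
      refine lt_of_le_of_ne (le_incl_iff.1 ha.le) fun he => ?_
      rcases a.exists_eq with ⟨x, rfl⟩ | ⟨b, hb, rfl⟩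
      · rw [incl_lt_iff] at ha
        exact ha.ne he
      · rw [minus_pos] at he
        rcases hb with h | ⟨x, hx, h⟩
        · exact y.2.2.ne (he.symm.trans h)
        · exact hy ((Subtype.ext (h.trans he) : x = y) ▸ hx.1)
    have hcont : ContinuousAt ((↑) : UI → ℝ) y := continuous_subtype_val.continuousAt
    filter_upwards [hcont.eventually (lt_mem_nhds h1)] with t ht
    exact IStar.lt_iff.2 (Or.inl ht)
  · have hcont : ContinuousAt ((↑) : UI → ℝ) y := continuous_subtype_val.continuousAt
    filter_upwards [hcont.eventually (gt_mem_nhds (incl_lt_iff.1 ha))] with t ht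
    exact incl_lt_iff.2 ht

/-- Neighbourhoods of `b⁻` are one-sided. -/
theorem eventually_le_minus {b : ℝ} (hb : IsMinusPos π b) : ∀ᶠ w in 𝓝 (minus hb), w ≤ minus hb := by
  rcases hb.le_one.eq_or_lt with h | h
  · exact Eventually.of_forall fun w => not_lt.1 fun hlt => by
      rcases IStar.lt_iff.1 hlt with h1 | ⟨h1, -, h2⟩
      · rw [minus_pos, h] at h1
        exact absurd w.pos_le_one (not_le.2 h1)
      · rw [minus_pos, h] at h1
        exact absurd (w.pos_mem h2).2 (by rw [← h1]; exact lt_irrefl _)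
  · have hlt : minus hb < incl π ⟨b, hb.pos.le, h⟩ :=
      (lt_incl_iff_le_minus (x := ⟨b, hb.pos.le, h⟩) (hx := hb)).2 le_rfl
    filter_upwards [gt_mem_nhds hlt] with w hw
    exact (lt_incl_iff_le_minus (x := ⟨b, hb.pos.le, h⟩) (hx := hb)).1 hw

/-- Neighbourhoods of `y⁺` are one-sided if `y` is doubled. -/
theorem eventually_incl_le {y : UI} (hy : y ∈ D π) : ∀ᶠ w in 𝓝 (incl π y), incl π y ≤ w := by
  by_cases h0 : y = zero
  · rw [h0]
    exact Eventually.of_forall incl_zero_le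
  · have hb := isMinusPos_of_mem_D hy h0
    have hlt : minus hb < incl π y := (lt_incl_iff_le_minus (hx := hb)).2 le_rfl
    filter_upwards [lt_mem_nhds hlt] with w hw
    exact not_lt.1 fun h => absurd ((lt_incl_iff_le_minus (hx := hb)).1 h) (not_le.2 hw)

theorem comap_incl_nhds_minus_le {b : ℝ} (hb : IsMinusPos π b) :
    comap (incl π) (𝓝 (minus hb)) ≤ comap ((↑) : UI → ℝ) (𝓝[<] b) := by
  rw [← tendsto_iff_comap, tendsto_nhdsWithin_iff]
  refine ⟨(continuous_pos.tendsto (minus hb)).comp tendsto_comap, ?_⟩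
  filter_upwards [(eventually_le_minus hb).comap (incl π)] with t ht
  exact incl_le_minus.1 ht

theorem comap_incl_nhds_incl_le {y : UI} (hy : y ∈ D π) :
    comap (incl π) (𝓝 (incl π y)) ≤ comap ((↑) : UI → ℝ) (𝓝[≥] (y : ℝ)) := by
  rw [← tendsto_iff_comap, tendsto_nhdsWithin_iff]
  refine ⟨(continuous_pos.tendsto (incl π y)).comp tendsto_comap, ?_⟩
  filter_upwards [(eventually_incl_le hy).comap (incl π)] with t ht
  exact incl_le_incl.1 ht

theorem comap_incl_nhds_le (y : UI) : comap (incl π) (𝓝 (incl π y)) ≤ 𝓝 y := by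
  rw [nhds_subtype_eq_comap, ← tendsto_iff_comap]
  exact (continuous_pos.tendsto (incl π y)).comp tendsto_comap

theorem neBot_comap_left {b : ℝ} (h0 : 0 < b) (h1 : b ≤ 1) :
    (comap ((↑) : UI → ℝ) (𝓝[<] b)).NeBot := by
  rw [comap_neBot_iff]
  intro s hs
  obtain ⟨a, ha, has⟩ := (mem_nhdsLT_iff_exists_Ioo_subset' h0).1 hs
  obtain ⟨t, ht1, ht2⟩ := exists_mem_left h0 h1 (sub_pos.2 ha)
  exact ⟨t, has ⟨by linarith, ht2⟩⟩

theorem dense_range_incl : DenseRange (incl π) := by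
  intro z
  rcases z.exists_eq with ⟨x, rfl⟩ | ⟨b, hb, rfl⟩
  · exact subset_closure (mem_range_self x)
  · have := neBot_comap_left hb.pos hb.le_one
    exact mem_closure_of_tendsto (tendsto_incl_left hb)
      (Eventually.of_forall fun t => mem_range_self t)

theorem starMap_incl (x : UI) : starMap π (incl π x) = incl π (rotOdo π x) := by
  rw [starMap, dif_pos (incl_sign x)]
  rfl

theorem starMap_iterate_incl (x : UI) (k : ℕ) :
    (starMap π)^[k] (incl π x) = incl π ((rotOdo π)^[k] x) := by
  induction k with
  | zero => rfl
  | succ k ih => rw [Function.iterate_succ_apply', ih, starMap_incl, Function.iterate_succ_apply']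

/-- The endpoint of a translated interval on the left of a doubled point is again doubled. -/
theorem isMinusPos_add {b ε c : ℝ} (hb : IsMinusPos π b) (hε : 0 < ε)
    (h : ∀ t : UI, b - ε < t → (t : ℝ) < b → (rotOdo π t : ℝ) = t + c) : IsMinusPos π (b + c) := by
  obtain ⟨t₀, h1, h2⟩ := exists_mem_left hb.pos hb.le_one hε
  have hpos : 0 < b + c := by
    have := h t₀ h1 h2
    linarith [(rotOdo π t₀).2.1]
  have hle : b + c ≤ 1 := by
    by_contra hc
    obtain ⟨t, h3, h4⟩ := exists_mem_left hb.pos hb.le_one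
      (lt_min hε (sub_pos.2 (not_le.1 hc)))
    have e1 := min_le_left ε (b + c - 1)
    have e2 := min_le_right ε (b + c - 1)
    have h5 := h t (by linarith) h4
    linarith [(rotOdo π t).2.2]
  rcases hle.eq_or_lt with h3 | h3
  · exact Or.inl h3
  obtain ⟨u, hu⟩ := exists_rotOdo_eq π (w := ⟨b + c, hpos.le, h3⟩) hpos
  have huc : (rotOdo π u : ℝ) = b + c := by rw [hu]
  have hu0 : (⟨b + c, hpos.le, h3⟩ : UI) ≠ zero := fun h0 =>
    hpos.ne' (congrArg Subtype.val h0)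
  suffices hD : u ∈ D π by
    have := isMinusPos_of_mem_D (rotOdo_mem_D_iff.2 hD) (by rwa [hu])
    rwa [huc] at this
  by_cases hu1 : u ∈ D₀ π
  · exact D₀_subset_D π hu1
  -- otherwise points on the left of `u` and on the left of `b` share their images, so `u = b`
  obtain ⟨δ, hδ, hloc⟩ := local_translation π hu1
  have hupos : 0 < (u : ℝ) := pos_of_ne_zero fun h0 => hu1 (Or.inl h0)
  have hm : 0 < min (min ε δ) (min b u) :=
    lt_min (lt_min hε hδ) (lt_min hb.pos hupos)
  set m := min (min ε δ) (min b u) with hmd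
  have e1 : m ≤ ε := (min_le_left _ _).trans (min_le_left _ _)
  have e2 : m ≤ δ := (min_le_left _ _).trans (min_le_right _ _)
  have e3 : m ≤ b := (min_le_right _ _).trans (min_le_left _ _)
  have e4 : m ≤ u := (min_le_right _ _).trans (min_le_right _ _)
  set t : UI := ⟨b - m / 2, by linarith, by linarith [hb.le_one]⟩ with ht
  set s : UI := ⟨u - m / 2, by linarith, by linarith [u.2.2]⟩ with hs
  have htc : (t : ℝ) = b - m / 2 := rfl
  have hsc : (s : ℝ) = u - m / 2 := rfl
  have h4 := h t (by linarith) (by linarith)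
  have h5 := hloc s (by rw [abs_lt]; constructor <;> linarith)
  have h6 : t = s := rotOdo_injective π (Subtype.ext (by rw [h4, h5]; linarith))
  have h7 : (u : ℝ) = b := by
    have h8 : (t : ℝ) = s := by rw [h6]
    linarith
  rcases hb with hb1 | ⟨x, hx, hxb⟩
  · linarith [u.2.2]
  · rw [show u = x from Subtype.ext (h7.trans hxb.symm)]
    exact hx.1

/-- The limit defining `F_π^*` at `b⁻` exists. -/
theorem exists_tendsto_left {b : ℝ} (hb : IsMinusPos π b) :
    ∃ w, Tendsto (fun y : UI => incl π (rotOdo π y)) (comap ((↑) : UI → ℝ) (𝓝[<] b)) (𝓝 w) := by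
  have hev : ∀ ε > 0, ∀ᶠ t : UI in comap ((↑) : UI → ℝ) (𝓝[<] b), b - ε < t ∧ (t : ℝ) < b := by
    intro ε hε
    have h1 : ∀ᶠ s : ℝ in 𝓝[<] b, b - ε < s :=
      nhdsWithin_le_nhds (lt_mem_nhds (by linarith))
    have h2 : ∀ᶠ s : ℝ in 𝓝[<] b, s < b := eventually_mem_nhdsWithin
    exact (h1.and h2).comap _
  rcases left_germ π hb.pos hb.le_one with ⟨ε, hε, c, h⟩ | h
  · refine ⟨minus (isMinusPos_add hb hε h), (tendsto_incl_left _).comp ?_⟩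
    rw [tendsto_comap_iff, tendsto_nhdsWithin_iff]
    constructor
    · have h1 : Tendsto (fun t : UI => (t : ℝ) + c) (comap ((↑) : UI → ℝ) (𝓝[<] b)) (𝓝 (b + c)) :=
        ((tendsto_comap.mono_right nhdsWithin_le_nhds).add_const c)
      refine h1.congr' ?_
      filter_upwards [hev ε hε] with t ht
      exact (h t ht.1 ht.2).symm
    · filter_upwards [hev ε hε] with t ht
      have := h t ht.1 ht.2
      simp only [Function.comp_apply, mem_Iio]
      linarith
  · refine ⟨incl π zero, (tendsto_incl_right zero).comp ?_⟩
    rw [tendsto_comap_iff, tendsto_nhdsWithin_iff]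
    constructor
    · refine tendsto_order.2 ⟨fun a ha => ?_, fun a ha => ?_⟩
      · exact Eventually.of_forall fun t => ha.trans_le (rotOdo π t).2.1
      · obtain ⟨ε, hε, h1⟩ := h a ha
        filter_upwards [hev ε hε] with t ht
        exact h1 t ht.1 ht.2
    · exact Eventually.of_forall fun t => (rotOdo π t).2.1

theorem tendsto_starMap_left {b : ℝ} (hb : IsMinusPos π b) :
    Tendsto (fun y : UI => incl π (rotOdo π y)) (comap ((↑) : UI → ℝ) (𝓝[<] b))
      (𝓝 (starMap π (minus hb))) := by
  rw [starMap, dif_neg (by rw [minus_sign]; decide)]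
  exact tendsto_nhds_limUnder (exists_tendsto_left hb)

theorem tendsto_starMap (z : IStar π) :
    Tendsto (fun y : UI => incl π (rotOdo π y)) (comap (incl π) (𝓝 z)) (𝓝 (starMap π z)) := by
  rcases z.exists_eq with ⟨x, rfl⟩ | ⟨b, hb, rfl⟩
  · rw [starMap_incl]
    by_cases hx : x ∈ D π
    · refine ((tendsto_incl_right (rotOdo π x)).comp ?_).mono_left (comap_incl_nhds_incl_le hx)
      obtain ⟨ε, hε, h⟩ := right_germ π x
      have hev : ∀ᶠ t : UI in comap ((↑) : UI → ℝ) (𝓝[≥] (x : ℝ)),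
          (x : ℝ) ≤ t ∧ (t : ℝ) < x + ε := by
        have h1 : ∀ᶠ s : ℝ in 𝓝[≥] (x : ℝ), (x : ℝ) ≤ s ∧ s < x + ε :=
          eventually_mem_nhdsWithin.and (nhdsWithin_le_nhds (gt_mem_nhds (by linarith)))
        exact h1.comap _
      rw [tendsto_comap_iff, tendsto_nhdsWithin_iff]
      constructor
      · have h1 : Tendsto (fun t : UI => (rotOdo π x : ℝ) + ((t : ℝ) - x))
            (comap ((↑) : UI → ℝ) (𝓝[≥] (x : ℝ))) (𝓝 ((rotOdo π x : ℝ) + ((x : ℝ) - x))) :=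
          ((tendsto_comap.mono_right nhdsWithin_le_nhds).sub_const _).const_add _
        rw [sub_self, add_zero] at h1
        refine h1.congr' ?_
        filter_upwards [hev] with t ht
        exact (h t ht.1 ht.2).symm
      · filter_upwards [hev] with t ht
        have := h t ht.1 ht.2
        simp only [Function.comp_apply, mem_Ici]
        linarith
    · have hc : ContinuousAt (rotOdo π) x := by
        by_contra hc
        exact hx (D₀_subset_D π (Or.inr (Or.inr hc)))
      have h1 : ContinuousAt (incl π) (rotOdo π x) :=
        continuousAt_incl fun h => hx (rotOdo_mem_D_iff.1 h)
      exact (ContinuousAt.comp (g := incl π) h1 hc).mono_left (comap_incl_nhds_le x)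
  · exact (tendsto_starMap_left hb).mono_left (comap_incl_nhds_minus_le hb)

/-- By regularity of `I^*`, continuity only has to be tested along the dense subset `I`. -/
theorem continuous_starMap : Continuous (starMap π) := by
  have key : ∀ z, Tendsto (starMap π) (𝓝[range (incl π)] z) (𝓝 (starMap π z)) := by
    intro z
    rw [nhdsWithin, ← Filter.map_comap, tendsto_map'_iff]
    refine (tendsto_starMap z).congr fun x => ?_
    exact (starMap_incl x).symm
  have h := continuous_extendFrom (dense_range_incl (π := π)) fun z => ⟨_, key z⟩
  convert h using 1
  funext z
  exact (extendFrom_eq (dense_range_incl z) (key z)).symm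

/-- The order of `I^*` is complete, which makes `I^*` compact. -/
theorem exists_isLUB (S : Set (IStar π)) : ∃ z, IsLUB S z := by
  rcases S.eq_empty_or_nonempty with rfl | hne
  · exact ⟨incl π zero, by simp [isLUB_empty_iff, IsBot, incl_zero_le]⟩
  set s := sSup (IStar.pos '' S) with hs
  have hbdd : BddAbove (IStar.pos '' S) := ⟨1, by rintro _ ⟨z, -, rfl⟩; exact z.pos_le_one⟩
  have hle : ∀ z ∈ S, z.pos ≤ s := fun z hz => le_csSup hbdd (mem_image_of_mem _ hz)
  have hub : ∀ u ∈ upperBounds S, s ≤ u.pos := by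
    intro u hu
    refine csSup_le (hne.image _) ?_
    rintro _ ⟨z, hz, rfl⟩
    by_contra hc
    exact absurd (hu hz) (not_le.2 (IStar.lt_iff.2 (Or.inl (not_le.1 hc))))
  obtain ⟨z₀, hz₀⟩ := hne
  have hs0 : 0 ≤ s := z₀.pos_nonneg.trans (hle z₀ hz₀)
  by_cases h1 : ∃ x : UI, (x : ℝ) = s ∧ incl π x ∈ S
  · obtain ⟨x, hx, hxS⟩ := h1
    exact ⟨incl π x, fun z hz => le_incl_iff.2 (by rw [hx]; exact hle z hz), fun u hu => hu hxS⟩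
  by_cases h2 : IsMinusPos π s
  · refine ⟨minus h2, fun z hz => ?_, fun u hu => minus_le_iff.2 (hub u hu)⟩
    rcases z.exists_eq with ⟨x, rfl⟩ | ⟨b, hb, rfl⟩
    · refine incl_le_minus.2 (lt_of_le_of_ne (hle _ hz) fun h => h1 ⟨x, h, hz⟩)
    · exact minus_le_iff.2 (hle _ hz)
  · have hs1 : s < 1 := lt_of_le_of_ne (csSup_le ⟨_, mem_image_of_mem _ hz₀⟩
      (by rintro _ ⟨z, -, rfl⟩; exact z.pos_le_one)) fun h => h2 (Or.inl h)
    refine ⟨incl π ⟨s, hs0, hs1⟩, fun z hz => le_incl_iff.2 (hle z hz), fun u hu => ?_⟩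
    rcases u.exists_eq with ⟨x, rfl⟩ | ⟨b, hb, rfl⟩
    · exact incl_le_incl.2 (hub _ hu)
    · refine incl_le_minus.2 (lt_of_le_of_ne (hub _ hu) fun h => h2 ?_)
      change s = b at h
      rwa [h]

instance : CompactSpace (IStar π) := by
  constructor
  rw [isCompact_iff_ultrafilter_le_nhds]
  intro f _
  obtain ⟨z, hz⟩ := exists_isLUB {w : IStar π | Ici w ∈ f}
  refine ⟨z, mem_univ z, ?_⟩
  have : Tendsto id (f : Filter (IStar π)) (𝓝 z) := by
    refine tendsto_order.2 ⟨fun a ha => ?_, fun a ha => ?_⟩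
    · obtain ⟨w, hw, haw⟩ := (lt_isLUB_iff hz).1 ha
      exact mem_of_superset hw fun v hv => haw.trans_le hv
    · by_contra hc
      have h1 : {v : IStar π | id v < a}ᶜ ∈ f := Ultrafilter.compl_mem_iff_notMem.2 hc
      have h2 : Ici a ∈ f := mem_of_superset h1 fun v hv => not_lt.1 (show ¬ v < a from hv)
      exact absurd (hz.1 h2) (not_le.2 ha)
  exact this

theorem exists_rat_between {r s : ℝ} (hr : 0 ≤ r) (hrs : r < s) (hs : s ≤ 1) :
    ∃ t : UI, (t : ℝ) ∈ range ((↑) : ℚ → ℝ) ∧ r < t ∧ (t : ℝ) < s := by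
  obtain ⟨p, h1, h2⟩ := exists_rat_btwn hrs
  exact ⟨⟨p, hr.trans h1.le, h2.trans_le hs⟩, ⟨p, rfl⟩, h1, h2⟩

theorem countable_minus : {z : IStar π | z.sign = false}.Countable := by
  have hinj : InjOn (IStar.pos : IStar π → ℝ) {z | z.sign = false} := by
    intro z hz w hw h
    refine le_antisymm (not_lt.1 fun hl => ?_) (not_lt.1 fun hl => ?_)
    · rcases IStar.lt_iff.1 hl with h1 | ⟨-, -, h1⟩
      · exact h1.ne h.symm
      · exact absurd (h1.symm.trans hz) (by decide)
    · rcases IStar.lt_iff.1 hl with h1 | ⟨-, -, h1⟩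
      · exact h1.ne h
      · exact absurd (h1.symm.trans hw) (by decide)
  refine MapsTo.countable_of_injOn (f := IStar.pos) (t := {1} ∪ ((↑) : UI → ℝ) '' (D π)) ?_ hinj
    ((countable_singleton _).union ((countable_D π).image _))
  intro z hz
  rcases z.exists_eq with ⟨x, rfl⟩ | ⟨b, hb, rfl⟩
  · exact absurd hz (by simp [incl_sign])
  · rcases hb with h | ⟨x, hx, h⟩
    · exact Or.inl h
    · exact Or.inr ⟨x, hx.1, h⟩

/-- The points `x⁺` with `x` rational or in `D`, together with the points `x⁻`, form a countable
set whose rays generate the topology of `I^*`. -/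
instance : SecondCountableTopology (IStar π) := by
  set C : Set (IStar π) := incl π '' ((↑) ⁻¹' range ((↑) : ℚ → ℝ) ∪ D π) ∪
    {z | z.sign = false} with hC
  have hCc : C.Countable := by
    refine Countable.union (Countable.image (Countable.union ?_ (countable_D π)) _) ?_
    · exact (countable_range _).preimage_of_injOn Subtype.val_injective.injOn
    · exact countable_minus
  refine ⟨⟨Ioi '' C ∪ Iio '' C, (hCc.image _).union (hCc.image _), ?_⟩⟩
  refine le_antisymm ?_ ?_
  · refine le_generateFrom ?_
    rintro _ (⟨a, -, rfl⟩ | ⟨a, -, rfl⟩)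
    · exact isOpen_Ioi
    · exact isOpen_Iio
  · rw [OrderTopology.topology_eq_generate_intervals (α := IStar π)]
    refine le_generateFrom ?_
    have hCi : ∀ a ∈ C, IsOpen[TopologicalSpace.generateFrom (Ioi '' C ∪ Iio '' C)] (Ioi a) :=
      fun a ha => TopologicalSpace.isOpen_generateFrom_of_mem (Or.inl ⟨a, ha, rfl⟩)
    have hCi' : ∀ a ∈ C, IsOpen[TopologicalSpace.generateFrom (Ioi '' C ∪ Iio '' C)] (Iio a) :=
      fun a ha => TopologicalSpace.isOpen_generateFrom_of_mem (Or.inr ⟨a, ha, rfl⟩)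
    rintro _ ⟨a, rfl | rfl⟩
    · by_cases ha : a ∈ C
      · exact hCi a ha
      have he : Ioi a = ⋃ c ∈ C ∩ Ioi a, Ioi c := by
        ext w
        simp only [mem_Ioi, mem_iUnion, exists_prop]
        refine ⟨fun haw => ?_, fun ⟨c, hc, hcw⟩ => (show a < c from hc.2).trans hcw⟩
        rcases a.exists_eq with ⟨x, rfl⟩ | ⟨b, hb, rfl⟩
        · obtain ⟨t, ht, h1, h2⟩ := exists_rat_between x.2.1 (incl_lt_iff.1 haw) w.pos_le_one
          exact ⟨incl π t, ⟨Or.inl ⟨t, Or.inl ht, rfl⟩, incl_lt_iff.2 h1⟩, incl_lt_iff.2 h2⟩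
        · exact absurd (Or.inr rfl) ha
      rw [he]
      let _ := TopologicalSpace.generateFrom (Ioi '' C ∪ Iio '' C)
      exact isOpen_biUnion fun c hc => hCi c hc.1
    · by_cases ha : a ∈ C
      · exact hCi' a ha
      have he : Iio a = ⋃ c ∈ C ∩ Iio a, Iio c := by
        ext w
        simp only [mem_Iio, mem_iUnion, exists_prop]
        refine ⟨fun haw => ?_, fun ⟨c, hc, hcw⟩ => lt_trans hcw (show c < a from hc.2)⟩
        rcases a.exists_eq with ⟨x, rfl⟩ | ⟨b, hb, rfl⟩
        · have hx : x ∉ D π := fun h => ha (Or.inl ⟨x, Or.inr h, rfl⟩)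
          have hwx : w.pos < x := by
            rcases IStar.lt_iff.1 haw with h | ⟨h, h', -⟩
            · exact h
            · exfalso
              rcases w.exists_eq with ⟨y, rfl⟩ | ⟨b, hb, rfl⟩
              · exact absurd h' (by simp [incl_sign])
              · rcases hb with h1 | ⟨y, hy, h1⟩
                · exact x.2.2.ne (h.symm.trans h1)
                · exact hx ((Subtype.ext (h1.trans h) : y = x) ▸ hy.1)
          obtain ⟨t, ht, h1, h2⟩ := exists_rat_between w.pos_nonneg hwx x.2.2.le
          exact ⟨incl π t, ⟨Or.inl ⟨t, Or.inl ht, rfl⟩, IStar.lt_iff.2 (Or.inl h2)⟩,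
            IStar.lt_iff.2 (Or.inl h1)⟩
        · exact absurd (Or.inr rfl) ha
      rw [he]
      let _ := TopologicalSpace.generateFrom (Ioi '' C ∪ Iio '' C)
      exact isOpen_biUnion fun c hc => hCi' c hc.1

end Compactification

/-! ### The minimal set -/

section Minimal

variable {q : ℕ} [NeZero q] {π : Equiv.Perm (Fin q)}

theorem isOpen_starPerPart : IsOpen (starPerPart π) := by
  rw [isOpen_iff_mem_nhds]
  rintro z ⟨x, b, hx, hb, hxb, hper, hxz, hzb⟩
  have h1 : ∀ᶠ w in 𝓝 z, incl π x ≤ w := by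
    rcases hxz.eq_or_lt with rfl | h
    · exact eventually_incl_le hx
    · exact (lt_mem_nhds h).mono fun w hw => hw.le
  have h2 : ∀ᶠ w in 𝓝 z, w ≤ b := by
    rcases hzb.eq_or_lt with rfl | h
    · rcases z.exists_eq with ⟨y, rfl⟩ | ⟨c, hc, rfl⟩
      · exact absurd hb (by simp [incl_sign])
      · exact eventually_le_minus hc
    · exact (gt_mem_nhds h).mono fun w hw => hw.le
  filter_upwards [h1, h2] with w hw1 hw2
  exact ⟨x, b, hx, hb, hxb, hper, hw1, hw2⟩

theorem incl_mem_starPerPart_iff {x : UI} : incl π x ∈ starPerPart π ↔ x ∈ perPart π := by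
  constructor
  · rintro ⟨y, b, -, hb, -, hper, hyx, hxb⟩
    refine hper x (incl_le_incl.1 hyx) ?_
    rcases b.exists_eq with ⟨c, rfl⟩ | ⟨c, hc, rfl⟩
    · exact absurd hb (by simp [incl_sign])
    · exact incl_le_minus.1 hxb
  · intro hx
    obtain ⟨l, hl, hlx, y, hxy, hy, hper⟩ := exists_periodic_interval hx
    have hyM : IsMinusPos π y := hy
    exact ⟨l, minus hyM, hl, minus_sign _, lt_of_le_of_lt hlx hxy, hper, incl_le_incl.2 hlx,
      incl_le_minus.2 hxy⟩

theorem minus_mem_starPerPart {b ε : ℝ} (hb : IsMinusPos π b) (hε : 0 < ε)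
    (h : ∀ t : UI, b - ε < t → (t : ℝ) < b → t ∈ perPart π) : minus hb ∈ starPerPart π := by
  obtain ⟨t, ht1, ht2⟩ := exists_mem_left hb.pos hb.le_one hε
  obtain ⟨l, hl, hlt, y, hty, -, hper⟩ := exists_periodic_interval (h t ht1 ht2)
  have hlb : (l : ℝ) < b := lt_of_le_of_lt (Subtype.coe_le_coe.2 hlt) ht2
  refine ⟨l, minus hb, hl, minus_sign _, hlb, fun s hls hsb => ?_, incl_le_minus.2 hlb, le_rfl⟩
  rcases lt_or_ge (s : ℝ) y with hs | hs
  · exact hper s hls hs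
  · exact h s (by linarith) hsb

/-- Every orbit in the aperiodic part comes arbitrarily close to `0⁺`. -/
theorem exists_starMap_iterate_le {z : IStar π} (hz : z ∈ starNpPart π) {y : UI}
    (hy : 0 < (y : ℝ)) : ∃ j, (starMap π)^[j] z ≤ incl π y := by
  obtain ⟨n, hn⟩ := exists_half_pow_lt hy
  rcases z.exists_eq with ⟨x, rfl⟩ | ⟨b, hb, rfl⟩
  · have hx : x ∉ perPart π := fun h => hz (incl_mem_starPerPart_iff.2 h)
    rcases cell_periodic_or_visits π n (block (q * 2 ^ n) x) with h | ⟨j, h⟩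
    · exact absurd (h x rfl) hx
    · refine ⟨j, ?_⟩
      rw [starMap_iterate_incl]
      exact incl_le_incl.2 (Subtype.coe_le_coe.1 ((h x rfl).le.trans hn.le))
  · obtain ⟨k, ε, hε, hk⟩ := exists_left_cell (q * 2 ^ n) hb.pos hb.le_one
    rcases cell_periodic_or_visits π n k with h | ⟨j, h⟩
    · exact absurd (minus_mem_starPerPart hb hε fun t h1 h2 => h t (hk t h1 h2)) hz
    · refine ⟨j, ?_⟩
      have := neBot_comap_left hb.pos hb.le_one
      have hlim := ((continuous_starMap (π := π)).iterate j).continuousAt.tendsto.comp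
        (tendsto_incl_left hb)
      refine le_of_tendsto hlim ?_
      have h1 : ∀ᶠ s : ℝ in 𝓝[<] b, b - ε < s :=
        nhdsWithin_le_nhds (lt_mem_nhds (by linarith))
      have h2 : ∀ᶠ s : ℝ in 𝓝[<] b, s < b := eventually_mem_nhdsWithin
      filter_upwards [(h1.and h2).comap ((↑) : UI → ℝ)] with t ht
      rw [Function.comp_apply, starMap_iterate_incl]
      exact incl_le_incl.2 (Subtype.coe_le_coe.1 ((h t (hk t ht.1 ht.2)).le.trans hn.le))

theorem incl_zero_mem_of_isSubsystem {A : Set (IStar π)} (hA : IsSubsystem (starMap π) A)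
    (hsub : A ⊆ starNpPart π) : incl π zero ∈ A := by
  obtain ⟨⟨z, hz⟩, hclosed, hmaps⟩ := hA
  by_contra hc
  have hopen : Aᶜ ∈ 𝓝 (incl π zero) := hclosed.isOpen_compl.mem_nhds hc
  have h1 : incl π zero ∈ Iio (incl π ⟨1 / 2, by norm_num, by norm_num⟩) :=
    incl_lt_iff.2 (by simp [incl_pos, zero])
  obtain ⟨b, hb, hsubset⟩ := (mem_nhdsGE_iff_exists_Ico_subset' h1).1
    (mem_nhdsWithin_of_mem_nhds hopen)
  have hbpos : 0 < b.pos := incl_lt_iff.1 hb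
  obtain ⟨y, hy1, hy2⟩ := exists_mem_of_lt le_rfl hbpos b.pos_le_one
  obtain ⟨j, hj⟩ := exists_starMap_iterate_le (hsub hz) hy1
  have hjA : (starMap π)^[j] z ∈ A := hmaps.iterate j hz
  exact hsubset ⟨incl_zero_le _, hj.trans_lt (incl_lt_iff.2 hy2)⟩ hjA

variable (π) in
/-- The closure of the orbit of `0⁺`, which turns out to be the unique minimal set. -/
def minimalSet : Set (IStar π) := closure (range fun k => incl π ((rotOdo π)^[k] zero))

theorem minimalSet_subset : minimalSet π ⊆ starNpPart π := by
  refine closure_minimal ?_ isOpen_starPerPart.isClosed_compl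
  rintro _ ⟨k, rfl⟩ h
  exact zero_notMem_perPart π (mem_perPart_of_iterate π (incl_mem_starPerPart_iff.1 h))

theorem isSubsystem_minimalSet : IsSubsystem (starMap π) (minimalSet π) := by
  refine ⟨⟨_, subset_closure (mem_range_self 0)⟩, isClosed_closure, ?_⟩
  refine MapsTo.closure ?_ continuous_starMap
  rintro _ ⟨k, rfl⟩
  refine ⟨k + 1, ?_⟩
  simp only [starMap_incl, Function.iterate_succ_apply']

theorem minimalSet_subset_of_isSubsystem {A : Set (IStar π)} (hA : IsSubsystem (starMap π) A)
    (hsub : A ⊆ starNpPart π) : minimalSet π ⊆ A := by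
  refine closure_minimal ?_ hA.2.1
  rintro _ ⟨k, rfl⟩
  have := hA.2.2.iterate k (incl_zero_mem_of_isSubsystem hA hsub)
  rwa [starMap_iterate_incl] at this

theorem isMinimalIn_minimalSet : IsMinimalIn (starMap π) (starNpPart π) (minimalSet π) :=
  ⟨minimalSet_subset, isSubsystem_minimalSet, fun _ hsub hA =>
    hsub.antisymm (minimalSet_subset_of_isSubsystem hA (hsub.trans minimalSet_subset))⟩

theorem eq_minimalSet {A : Set (IStar π)} (hA : IsMinimalIn (starMap π) (starNpPart π) A) :
    A = minimalSet π :=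
  (hA.2.2 _ (minimalSet_subset_of_isSubsystem hA.2.1 hA.1) isSubsystem_minimalSet).symm

/-- The orbit of a periodic point would be a subsystem, hence contain `0⁺`. -/
theorem iterate_ne_of_mem_minimalSet {z : IStar π} (hM : z ∈ minimalSet π) {m : ℕ} (hm : m ≠ 0) :
    (starMap π)^[m] z ≠ z := by
  intro hz
  have hper : Function.IsPeriodicPt (starMap π) m z := hz
  set A : Set (IStar π) := range fun k => (starMap π)^[k] z with hA
  have hfin : A.Finite := by
    refine ((finite_lt_nat m).image fun k => (starMap π)^[k] z).subset ?_
    rintro _ ⟨k, rfl⟩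
    exact ⟨k % m, Nat.mod_lt _ (Nat.pos_of_ne_zero hm), hper.iterate_mod_apply k⟩
  have hsub : IsSubsystem (starMap π) A := by
    refine ⟨⟨z, 0, rfl⟩, hfin.isClosed, ?_⟩
    rintro _ ⟨k, rfl⟩
    exact ⟨k + 1, Function.iterate_succ_apply' _ _ _⟩
  have hAM : A ⊆ starNpPart π := by
    rintro _ ⟨k, rfl⟩
    exact minimalSet_subset (isSubsystem_minimalSet.2.2.iterate k hM)
  obtain ⟨k, hk⟩ := incl_zero_mem_of_isSubsystem hsub hAM
  have h1 : (starMap π)^[m] (incl π zero) = incl π zero := by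
    change (starMap π)^[k] z = incl π zero at hk
    rw [← hk, ← Function.iterate_add_apply, add_comm, Function.iterate_add_apply, hz]
  rw [starMap_iterate_incl] at h1
  exact zero_notMem_perPart π ⟨m, Nat.pos_of_ne_zero hm, incl_injective h1⟩

end Minimal

/-! ### Measures and grid cells -/

section Masses

variable {q : ℕ} [NeZero q] {π : Equiv.Perm (Fin q)}

theorem block_eq_of_le {n m : ℕ} (hnm : n ≤ m) {x y : UI}
    (h : block (q * 2 ^ m) x = block (q * 2 ^ m) y) :
    block (q * 2 ^ n) x = block (q * 2 ^ n) y := by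
  have key : ∀ z : UI, (block (q * 2 ^ n) z : ℕ) = (block (q * 2 ^ m) z : ℕ) / 2 ^ (m - n) := by
    intro z
    change ⌊((q * 2 ^ n : ℕ) : ℝ) * z⌋₊ = ⌊((q * 2 ^ m : ℕ) : ℝ) * z⌋₊ / 2 ^ (m - n)
    rw [← Nat.floor_div_natCast]
    congr 1
    obtain ⟨d, rfl⟩ := Nat.exists_eq_add_of_le hnm
    rw [Nat.add_sub_cancel_left]
    push_cast
    rw [pow_add]
    field_simp
  apply Fin.ext
  rw [key, key, h]

theorem dist_lt_of_block_eq {N : ℕ} [NeZero N] {x y : UI} (h : block N x = block N y) :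
    |(x : ℝ) - y| < 1 / N := by
  have hN := cast_size_pos N
  have h1 := block_le (q := N) x
  have h2 := lt_block (q := N) x
  have h3 := block_le (q := N) y
  have h4 := lt_block (q := N) y
  rw [← h] at h3 h4
  have e : |(x : ℝ) - y| * N = |(N : ℝ) * x - N * y| := by
    rw [← mul_sub, abs_mul, abs_of_pos hN, mul_comm]
  rw [lt_div_iff₀ hN, e, abs_lt]
  constructor <;> linarith

/-- A union of cells is measured by summing over the cells. -/
theorem measure_eq_sum_cell (μ : Measure UI) {N : ℕ} [NeZero N] {A : Set UI}
    [DecidablePred fun k => leftEnd N k ∈ A]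
    (hA : ∀ x y, block N x = block N y → x ∈ A → y ∈ A) :
    μ A = ∑ k with leftEnd N k ∈ A, μ (cell N k) := by
  have e : A = ⋃ k ∈ Finset.univ.filter fun k => leftEnd N k ∈ A, cell N k := by
    ext x
    simp only [Finset.mem_filter, Finset.mem_univ, true_and, mem_iUnion, exists_prop]
    constructor
    · intro hx
      exact ⟨block N x, hA _ _ (block_leftEnd _).symm hx, rfl⟩
    · rintro ⟨k, hk, rfl⟩
      exact hA _ _ (block_leftEnd _) hk
  conv_lhs => rw [e]
  refine measure_biUnion_finset ?_ fun k _ => measurableSet_cell k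
  intro k _ l _ hkl
  exact Set.disjoint_left.2 fun x hx hx' => hkl (hx.symm.trans hx')

theorem measureReal_eq_sum_cell (μ : Measure UI) [IsFiniteMeasure μ] {N : ℕ} [NeZero N]
    {A : Set UI} [DecidablePred fun k => leftEnd N k ∈ A]
    (hA : ∀ x y, block N x = block N y → x ∈ A → y ∈ A) :
    μ.real A = ∑ k with leftEnd N k ∈ A, μ.real (cell N k) := by
  rw [measureReal_def, measure_eq_sum_cell μ hA, ENNReal.toReal_sum fun _ _ => measure_ne_top _ _]
  rfl

/-- Cells generate the topology, so an inequality between the measures of cells is an inequality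
of measures. -/
theorem measure_le_of_cell_le (q : ℕ) [NeZero q] {μ ν : Measure UI} [IsFiniteMeasure μ]
    (h : ∀ n k, ν (cell (q * 2 ^ n) k) ≤ μ (cell (q * 2 ^ n) k)) : ν ≤ μ := by
  classical
  have hopen : ∀ U : Set UI, IsOpen U → ν U ≤ μ U := by
    intro U hU
    set V : ℕ → Set UI := fun n => {x | ∀ y, block (q * 2 ^ n) x = block (q * 2 ^ n) y → y ∈ U}
      with hV
    have hmono : Monotone V := fun n m hnm x hx y hy => hx y (block_eq_of_le hnm hy)
    have hsub : ∀ n, V n ⊆ U := fun n x hx => hx x rfl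
    have hUV : U = ⋃ n, V n := by
      refine Subset.antisymm (fun x hx => ?_) (iUnion_subset hsub)
      obtain ⟨ε, hε, hball⟩ := Metric.isOpen_iff.1 hU x hx
      obtain ⟨n, hn⟩ := exists_half_pow_lt hε
      refine mem_iUnion.2 ⟨n, fun y hy => hball ?_⟩
      rw [Metric.mem_ball, Subtype.dist_eq, Real.dist_eq]
      refine (dist_lt_of_block_eq hy.symm).trans (lt_of_le_of_lt ?_ hn)
      rw [div_pow, one_pow]
      apply one_div_le_one_div_of_le (by positivity)
      have : 1 ≤ q := Nat.one_le_iff_ne_zero.2 (NeZero.ne q)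
      exact_mod_cast Nat.le_mul_of_pos_left _ this
    conv_lhs => rw [hUV]
    rw [hmono.measure_iUnion]
    refine iSup_le fun n => ?_
    have hsat : ∀ x y, block (q * 2 ^ n) x = block (q * 2 ^ n) y → x ∈ V n → y ∈ V n :=
      fun x y hxy hx z hz => hx z (hxy.trans hz)
    refine le_trans ?_ (measure_mono (hsub n))
    rw [measure_eq_sum_cell ν hsat, measure_eq_sum_cell μ hsat]
    exact Finset.sum_le_sum fun k _ => h n k
  refine Measure.le_iff'.2 fun s => ?_
  rw [s.measure_eq_iInf_isOpen μ]
  exact le_iInf fun U => le_iInf fun hs => le_iInf fun hU => (measure_mono hs).trans (hopen U hU)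

/-! ### The number of ergodic measures -/

/-- The linear map sending `c` to the signed masses that `∑ j, c j • μ j` gives to the `q` cells
of `[0, 2⁻ⁿ)`. -/
def cellMass (q : ℕ) [NeZero q] {ι : Type*} [Fintype ι] (μ : ι → Measure UI) (n : ℕ) :
    (ι → ℝ) →ₗ[ℝ] (Fin q → ℝ) where
  toFun c i := ∑ j, c j * (μ j).real (cell (q * 2 ^ n)
    (Fin.castLE (Nat.le_mul_of_pos_right q (by positivity)) i))
  map_add' c d := by
    ext i
    simp [add_mul, Finset.sum_add_distrib]
  map_smul' a c := by
    ext i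
    simp [mul_assoc, Finset.mul_sum]

section Combination

variable {ι : Type*} [Fintype ι] {μ : ι → Measure UI}

theorem sum_cell_eq_zero (hinv : ∀ j, MeasurePreserving (rotOdo π) (μ j) (μ j))
    (hper : ∀ j, μ j (perPart π) = 0) {n : ℕ} {c : ι → ℝ}
    (hc : c ∈ LinearMap.ker (cellMass q μ n)) (k : Fin (q * 2 ^ n)) :
    ∑ j, c j * (μ j).real (cell (q * 2 ^ n) k) = 0 := by
  rcases cell_periodic_or_measure_eq π n k with h | ⟨i, hi, h⟩
  · refine Finset.sum_eq_zero fun j _ => ?_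
    rw [measureReal_def, measure_mono_null h (hper j), ENNReal.toReal_zero, mul_zero]
  · have h1 := congrFun (LinearMap.mem_ker.1 hc) ⟨i, hi⟩
    change ∑ j, c j * (μ j).real (cell (q * 2 ^ n) i) = 0 at h1
    refine Eq.trans (Finset.sum_congr rfl fun j _ => ?_) h1
    rw [measureReal_def, measureReal_def, h _ (hinv j)]

theorem ker_cellMass_antitone [∀ j, IsFiniteMeasure (μ j)]
    (hinv : ∀ j, MeasurePreserving (rotOdo π) (μ j) (μ j)) (hper : ∀ j, μ j (perPart π) = 0) :
    Antitone fun n => LinearMap.ker (cellMass q μ n) := by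
  classical
  intro n m hnm c hc
  rw [LinearMap.mem_ker]
  ext i
  set k : Fin (q * 2 ^ n) := Fin.castLE (Nat.le_mul_of_pos_right q (by positivity)) i
  have hsat : ∀ x y, block (q * 2 ^ m) x = block (q * 2 ^ m) y → x ∈ cell (q * 2 ^ n) k →
      y ∈ cell (q * 2 ^ n) k := fun x y hxy hx => (block_eq_of_le hnm hxy).symm.trans hx
  change ∑ j, c j * (μ j).real (cell (q * 2 ^ n) k) = 0
  calc ∑ j, c j * (μ j).real (cell (q * 2 ^ n) k)
      = ∑ j, ∑ l with leftEnd (q * 2 ^ m) l ∈ cell (q * 2 ^ n) k,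
          c j * (μ j).real (cell (q * 2 ^ m) l) := by
        refine Finset.sum_congr rfl fun j _ => ?_
        rw [measureReal_eq_sum_cell (μ j) hsat, Finset.mul_sum]
    _ = 0 := by
        rw [Finset.sum_comm]
        exact Finset.sum_eq_zero fun l _ => sum_cell_eq_zero hinv hper hc l

/-- More than `q` invariant measures of `I_np` are linearly dependent: the relations among their
masses on cells form a decreasing sequence of nonzero subspaces. -/
theorem exists_relation [∀ j, IsFiniteMeasure (μ j)]
    (hinv : ∀ j, MeasurePreserving (rotOdo π) (μ j) (μ j)) (hper : ∀ j, μ j (perPart π) = 0)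
    (hcard : q < Fintype.card ι) :
    ∃ c : ι → ℝ, c ≠ 0 ∧ ∀ n k, ∑ j, c j * (μ j).real (cell (q * 2 ^ n) k) = 0 := by
  have hanti := ker_cellMass_antitone hinv hper
  obtain ⟨n, hn⟩ := IsArtinian.monotone_stabilizes
    (⟨fun n => OrderDual.toDual (LinearMap.ker (cellMass q μ n)), fun _ _ h => hanti h⟩ :
      ℕ →o (Submodule ℝ (ι → ℝ))ᵒᵈ)
  have hne : LinearMap.ker (cellMass q μ n) ≠ ⊥ :=
    LinearMap.ker_ne_bot_of_finrank_lt (by simpa using hcard)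
  obtain ⟨c, hc, hc0⟩ := Submodule.exists_mem_ne_zero_of_ne_bot hne
  refine ⟨c, hc0, fun m k => sum_cell_eq_zero hinv hper ?_ k⟩
  rcases le_total n m with h | h
  · have := hn m h
    change LinearMap.ker (cellMass q μ n) = LinearMap.ker (cellMass q μ m) at this
    rwa [← this]
  · exact hanti h hc

/-- Mutually singular probability measures satisfy no linear relation on cells. -/
theorem relation_nonpos [∀ j, IsProbabilityMeasure (μ j)]
    (hsing : Pairwise fun i j => (μ i).MutuallySingular (μ j)) {c : ι → ℝ}
    (hc : ∀ n k, ∑ j, c j * (μ j).real (cell (q * 2 ^ n) k) = 0) (i : ι) : c i ≤ 0 := by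
  by_contra hi
  push Not at hi
  set P : Measure UI := ∑ j, ENNReal.ofReal (c j) • μ j with hP
  set Q : Measure UI := ∑ j, ENNReal.ofReal (-c j) • μ j with hQ
  have hfin : ∀ j, IsFiniteMeasure (ENNReal.ofReal (-c j) • μ j) := fun j =>
    (μ j).smul_finite ENNReal.ofReal_ne_top
  have happ : ∀ (d : ι → ℝ) (s : Set UI), (∑ j, ENNReal.ofReal (d j) • μ j) s =
      ENNReal.ofReal (∑ j, max (d j) 0 * (μ j).real s) := by
    intro d s
    rw [Measure.finsetSum_apply, ENNReal.ofReal_sum_of_nonneg fun j _ => by positivity]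
    refine Finset.sum_congr rfl fun j _ => ?_
    rw [Measure.smul_apply, smul_eq_mul, ENNReal.ofReal_mul (le_max_right _ _), measureReal_def,
      ENNReal.ofReal_toReal (measure_ne_top _ _)]
    congr 1
    rcases le_total (d j) 0 with h | h
    · rw [max_eq_right h, ENNReal.ofReal_of_nonpos h, ENNReal.ofReal_zero]
    · rw [max_eq_left h]
  have hPQ : P ≤ Q := by
    refine measure_le_of_cell_le q fun n k => ?_
    rw [hP, hQ, happ, happ (fun j => -c j)]
    refine ENNReal.ofReal_le_ofReal (le_of_eq ?_)
    rw [← sub_eq_zero, ← Finset.sum_sub_distrib]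
    refine Eq.trans (Finset.sum_congr rfl fun j _ => ?_) (hc n k)
    rw [← sub_mul]
    congr 1
    rcases le_total (c j) 0 with h | h
    · rw [max_eq_right h, max_eq_left (by linarith)]; ring
    · rw [max_eq_left h, max_eq_right (by linarith)]; ring
  have hac : μ i ≪ Q := by
    intro s hs
    have h1 : P s = 0 := le_antisymm ((hPQ s).trans hs.le) bot_le
    rw [hP, Measure.finsetSum_apply, Finset.sum_eq_zero_iff] at h1
    have h2 := h1 i (Finset.mem_univ i)
    rw [Measure.smul_apply, smul_eq_mul, mul_eq_zero, ENNReal.ofReal_eq_zero] at h2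
    exact h2.resolve_left (not_le.2 hi)
  have hms : (μ i).MutuallySingular Q := by
    rw [hQ, ← Measure.sum_fintype, Measure.MutuallySingular.sum_right]
    intro j
    by_cases hij : i = j
    · rw [← hij, ENNReal.ofReal_of_nonpos (by linarith), zero_smul]
      exact Measure.MutuallySingular.zero_right
    · exact (hsing hij).mono_ac Measure.AbsolutelyContinuous.rfl Measure.smul_absolutelyContinuous
  exact IsProbabilityMeasure.ne_zero (μ i)
    (Measure.eq_zero_of_absolutelyContinuous_of_mutuallySingular hac hms)

end Combination

theorem encard_ergodicMeasures_le (π : Equiv.Perm (Fin q)) : (ergodicMeasures π).encard ≤ q := by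
  by_contra h
  push Not at h
  obtain ⟨T, hT, hcard⟩ := exists_subset_encard_eq (Order.add_one_le_of_lt h)
  have hfin : T.Finite := finite_of_encard_eq_coe (k := q + 1) (by rw [hcard]; norm_cast)
  have := hfin.fintype
  have hq : Fintype.card T = q + 1 := by
    rw [← Set.toFinset_card, ← ENat.natCast_inj, ← Set.encard_coe_eq_coe_finsetCard,
      Set.coe_toFinset, hcard]
    norm_cast
  set μ : T → Measure UI := Subtype.val with hμ
  have hprob : ∀ j, IsProbabilityMeasure (μ j) := fun j => (hT j.2).1
  have herg : ∀ j, Ergodic (rotOdo π) (μ j) := fun j => (hT j.2).2.2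
  have hper : ∀ j, μ j (perPart π) = 0 := fun j => by simpa [npPart] using (hT j.2).2.1
  have hsing : Pairwise fun i j => (μ i).MutuallySingular (μ j) := fun i j hij =>
    (herg i).mutuallySingular_of_ne (herg j) fun he => hij (Subtype.ext he)
  obtain ⟨c, hc0, hc⟩ := exists_relation (fun j => (herg j).toMeasurePreserving) hper (by omega)
  refine hc0 (funext fun j => le_antisymm (relation_nonpos hsing hc j) ?_)
  have h1 := relation_nonpos hsing (c := -c) (q := q)
    (fun n k => by simpa [neg_mul, Finset.sum_neg_distrib] using hc n k) j
  simpa using h1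

end Masses

/-! ### Unique ergodicity along the orbit of `0` -/

section Comparison

variable {q : ℕ} [NeZero q] {π : Equiv.Perm (Fin q)}

/-- The finite measures on `I` that come from invariant measures of the minimal set: invariant,
concentrated on the aperiodic part, and null on every cell that the orbit of `0` avoids. -/
structure IsAdmissible (π : Equiv.Perm (Fin q)) (μ : Measure UI) : Prop where
  invariant : MeasurePreserving (rotOdo π) μ μ
  perPart_null : μ (perPart π) = 0
  unvisited_null : ∀ n i, (∀ k, block (q * 2 ^ n) ((rotOdo π)^[k] zero) ≠ i) →
    μ (cell (q * 2 ^ n) i) = 0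

theorem exists_block_iterate_eq (π : Equiv.Perm (Fin q)) (x : UI) (t : ℕ) :
    ∃ ε > 0, ∀ y : UI, x ≤ y → (y : ℝ) < x + ε → ∀ j ≤ t,
      block q ((rotOdo π)^[j] y) = block q ((rotOdo π)^[j] x) := by
  induction t with
  | zero =>
    obtain ⟨ε, hε, h⟩ := exists_right_cell q x
    refine ⟨ε, hε, fun y h1 h2 j hj => ?_⟩
    obtain rfl : j = 0 := by omega
    exact h y h1 h2
  | succ t ih =>
    obtain ⟨ε₁, h₁, ih⟩ := ih
    obtain ⟨ε₂, h₂, hr⟩ := right_germ_iterate π x (t + 1)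
    obtain ⟨ε₃, h₃, hc⟩ := exists_right_cell q ((rotOdo π)^[t + 1] x)
    refine ⟨min (min ε₁ ε₂) ε₃, lt_min (lt_min h₁ h₂) h₃, fun y hxy hy j hj => ?_⟩
    have e1 := min_le_left (min ε₁ ε₂) ε₃
    have e2 := min_le_right (min ε₁ ε₂) ε₃
    have e3 := min_le_left ε₁ ε₂
    have e4 := min_le_right ε₁ ε₂
    rcases Nat.lt_or_ge j (t + 1) with h | h
    · exact ih y hxy (by linarith) j (by omega)
    · obtain rfl : j = t + 1 := by omega
      have h5 := hr y hxy (by linarith) (t + 1) le_rfl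
      have hxy' : (x : ℝ) ≤ y := hxy
      exact hc _ (Subtype.coe_le_coe.1 (by linarith)) (by linarith)

/-- As there are finitely many permutations of `q` symbols, a single neighbourhood `[0, 2⁻ˢ)` of
`0` follows, for each of them, the orbit of `0` until it has seen any given symbol that it ever
sees. -/
theorem exists_uniform_scale (q : ℕ) [NeZero q] : ∃ S : ℕ, ∀ (π : Equiv.Perm (Fin q)) (i : Fin q),
    (∃ t, block q ((rotOdo π)^[t] zero) = i) → ∃ t, block q ((rotOdo π)^[t] zero) = i ∧
      ∀ x : UI, (x : ℝ) < (1 / 2 : ℝ) ^ S → ∀ j ≤ t,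
        block q ((rotOdo π)^[j] x) = block q ((rotOdo π)^[j] zero) := by
  have hex : ∀ p : Equiv.Perm (Fin q) × Fin q, ∃ S : ℕ,
      (∃ t, block q ((rotOdo p.1)^[t] zero) = p.2) → ∃ t, block q ((rotOdo p.1)^[t] zero) = p.2 ∧
        ∀ x : UI, (x : ℝ) < (1 / 2 : ℝ) ^ S → ∀ j ≤ t,
          block q ((rotOdo p.1)^[j] x) = block q ((rotOdo p.1)^[j] zero) := by
    intro p
    by_cases h : ∃ t, block q ((rotOdo p.1)^[t] zero) = p.2
    · obtain ⟨t, ht⟩ := h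
      obtain ⟨ε, hε, hr⟩ := exists_block_iterate_eq p.1 zero t
      obtain ⟨S, hS⟩ := exists_half_pow_lt hε
      refine ⟨S, fun _ => ⟨t, ht, fun x hx => hr x x.2.1 ?_⟩⟩
      have h0 : (zero : ℝ) = 0 := rfl
      linarith
    · exact ⟨0, fun h' => absurd h' h⟩
  choose s hs using hex
  obtain ⟨S, hS⟩ := Finite.exists_le s
  refine ⟨S, fun π i h => ?_⟩
  obtain ⟨t, ht, hr⟩ := hs (π, i) h
  exact ⟨t, ht, fun x hx => hr x (hx.trans_le
    (pow_le_pow_of_le_one (by norm_num) (by norm_num) (hS (π, i))))⟩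

section Renormalization

variable {n : ℕ} {π' : Equiv.Perm (Fin q)} {τ : Fin q → ℕ}

/-- Points whose orbits under the renormalized map see the same symbols up to time `t` return to
`[0, 2⁻ⁿ)` for the `t`-th time simultaneously. -/
theorem exists_common_return_time
    (hτ : ∀ x, (rotOdo π)^[τ (block q x)] (scale n x) = scale n (rotOdo π' x)) (x₀ : UI) (t : ℕ) :
    ∃ K, ∀ x, (∀ j ≤ t, block q ((rotOdo π')^[j] x) = block q ((rotOdo π')^[j] x₀)) →
      (rotOdo π)^[K] (scale n x) = scale n ((rotOdo π')^[t] x) := by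
  induction t with
  | zero => exact ⟨0, fun x _ => rfl⟩
  | succ t ih =>
    obtain ⟨K, hK⟩ := ih
    refine ⟨τ (block q ((rotOdo π')^[t] x₀)) + K, fun x hx => ?_⟩
    rw [Function.iterate_add_apply, hK x fun j hj => hx j (by omega), ← hx t (by omega), hτ,
      Function.iterate_succ_apply']

theorem exists_return_of_lt (hτ1 : ∀ i, 1 ≤ τ i)
    (hτ : ∀ x, (rotOdo π)^[τ (block q x)] (scale n x) = scale n (rotOdo π' x) ∧
      ∀ k, 1 ≤ k → k < τ (block q x) → (1 / 2 : ℝ) ^ n ≤ (rotOdo π)^[k] (scale n x)) (k : ℕ) :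
    ∀ x, ((rotOdo π)^[k] (scale n x) : ℝ) < (1 / 2 : ℝ) ^ n →
      ∃ t, (rotOdo π)^[k] (scale n x) = scale n ((rotOdo π')^[t] x) := by
  induction k using Nat.strong_induction_on with
  | _ k ih =>
    intro x hx
    rcases Nat.eq_zero_or_pos k with rfl | hk
    · exact ⟨0, rfl⟩
    rcases Nat.lt_or_ge k (τ (block q x)) with h | h
    · exact absurd ((hτ x).2 k hk h) (not_le.2 hx)
    · obtain ⟨d, rfl⟩ := Nat.exists_eq_add_of_le' h
      have h1 := hτ1 (block q x)
      rw [Function.iterate_add_apply, (hτ x).1] at hx ⊢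
      obtain ⟨t, ht⟩ := ih d (by omega) _ hx
      exact ⟨t + 1, ht⟩

end Renormalization

/-- A cell of `[0, 2⁻ⁿ)` visited by the orbit of `0` contains an iterate of `[0, 2⁻ⁿ⁻ˢ)`, with `S`
independent of `n`. -/
theorem exists_iterate_subset_cell {S : ℕ} (hS : ∀ (π : Equiv.Perm (Fin q)) (i : Fin q),
    (∃ t, block q ((rotOdo π)^[t] zero) = i) → ∃ t, block q ((rotOdo π)^[t] zero) = i ∧
      ∀ x : UI, (x : ℝ) < (1 / 2 : ℝ) ^ S → ∀ j ≤ t,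
        block q ((rotOdo π)^[j] x) = block q ((rotOdo π)^[j] zero))
    (π : Equiv.Perm (Fin q)) (n : ℕ) {i : Fin (q * 2 ^ n)} (hi : (i : ℕ) < q)
    (hvis : ∃ k, block (q * 2 ^ n) ((rotOdo π)^[k] zero) = i) :
    ∃ K, ∀ z : UI, (z : ℝ) < (1 / 2 : ℝ) ^ (n + S) →
      (rotOdo π)^[K] z ∈ cell (q * 2 ^ n) i := by
  obtain ⟨π', τ, hτ1, hτ⟩ := exists_renormalization π n
  obtain ⟨k, hk⟩ := hvis
  have hlt : ((rotOdo π)^[k] (scale n zero) : ℝ) < (1 / 2 : ℝ) ^ n := by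
    rw [scale_zero, lt_half_pow_iff (q := q), hk]
    exact hi
  obtain ⟨t, ht⟩ := exists_return_of_lt hτ1 hτ k zero hlt
  have hblock : block q ((rotOdo π')^[t] zero) = ⟨i, hi⟩ := by
    apply Fin.ext
    rw [← block_scale (n := n), ← ht, scale_zero, hk]
  obtain ⟨t, ht, hr⟩ := hS π' ⟨i, hi⟩ ⟨t, hblock⟩
  obtain ⟨K, hK⟩ := exists_common_return_time (fun x => (hτ x).1) zero t
  refine ⟨K, fun z hz => ?_⟩
  have hz' : (z : ℝ) < (1 / 2 : ℝ) ^ n :=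
    hz.trans_le (pow_le_pow_of_le_one (by norm_num) (by norm_num) (by omega))
  obtain ⟨x, rfl⟩ := exists_scale_eq hz'
  have hx : (x : ℝ) < (1 / 2 : ℝ) ^ S := by
    rw [scale_coe, pow_add] at hz
    exact lt_of_mul_lt_mul_left hz (by positivity)
  have hrx := hr x hx
  rw [hK x hrx]
  change block (q * 2 ^ n) _ = i
  apply Fin.ext
  rw [block_scale, hrx t le_rfl, ht]

theorem cell_subset_lt_half_pow {n : ℕ} {i : Fin (q * 2 ^ n)} (hi : (i : ℕ) < q) :
    cell (q * 2 ^ n) i ⊆ {x : UI | (x : ℝ) < (1 / 2 : ℝ) ^ n} := by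
  rintro x rfl
  exact lt_half_pow_iff.2 hi

theorem measureReal_cell_le {μ : Measure UI} [IsFiniteMeasure μ]
    (hinv : MeasurePreserving (rotOdo π) μ μ) (hper : μ (perPart π) = 0) (n : ℕ)
    (k : Fin (q * 2 ^ n)) :
    μ.real (cell (q * 2 ^ n) k) ≤ μ.real {x : UI | (x : ℝ) < (1 / 2 : ℝ) ^ n} := by
  rcases cell_periodic_or_measure_eq π n k with h | ⟨i, hi, h⟩
  · rw [measureReal_def, measure_mono_null h hper, ENNReal.toReal_zero]
    exact measureReal_nonneg
  · rw [measureReal_def, h μ hinv]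
    exact measureReal_mono (cell_subset_lt_half_pow hi)

/-- Passing from `[0, 2⁻ⁿ)` to `[0, 2⁻ⁿ⁻ˢ)` loses at most a factor independent of `n`: the former
consists of `q 2ˢ` cells of level `n + S`, each of at most the mass of the latter. -/
theorem measureReal_lt_half_pow_le {μ : Measure UI} [IsFiniteMeasure μ]
    (hinv : MeasurePreserving (rotOdo π) μ μ) (hper : μ (perPart π) = 0) (n S : ℕ) :
    μ.real {x : UI | (x : ℝ) < (1 / 2 : ℝ) ^ n} ≤
      (q * 2 ^ S : ℕ) * μ.real {x : UI | (x : ℝ) < (1 / 2 : ℝ) ^ (n + S)} := by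
  classical
  set K : Finset (Fin (q * 2 ^ (n + S))) :=
    Finset.univ.filter fun k => (k : ℕ) < q * 2 ^ S with hK
  have hsub : {x : UI | (x : ℝ) < (1 / 2 : ℝ) ^ n} ⊆ ⋃ k ∈ K, cell (q * 2 ^ (n + S)) k := by
    intro x hx
    refine mem_iUnion₂.2 ⟨block (q * 2 ^ (n + S)) x, ?_, rfl⟩
    rw [hK, Finset.mem_filter]
    refine ⟨Finset.mem_univ _, ?_⟩
    have h1 := block_le (q := q * 2 ^ (n + S)) x
    have h2 : ((q * 2 ^ (n + S) : ℕ) : ℝ) * (x : ℝ) < (q * 2 ^ S : ℕ) := by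
      have hN := cast_size_pos (q * 2 ^ (n + S))
      calc ((q * 2 ^ (n + S) : ℕ) : ℝ) * (x : ℝ)
          < ((q * 2 ^ (n + S) : ℕ) : ℝ) * (1 / 2 : ℝ) ^ n := by
            exact mul_lt_mul_of_pos_left hx hN
        _ = (q * 2 ^ S : ℕ) := by
            push_cast
            rw [pow_add, div_pow, one_pow]
            field_simp
    exact_mod_cast h1.trans_lt h2
  calc μ.real {x : UI | (x : ℝ) < (1 / 2 : ℝ) ^ n}
      ≤ μ.real (⋃ k ∈ K, cell (q * 2 ^ (n + S)) k) := measureReal_mono hsub (measure_ne_top _ _)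
    _ ≤ ∑ k ∈ K, μ.real (cell (q * 2 ^ (n + S)) k) := measureReal_biUnion_finset_le _ _
    _ ≤ ∑ _k ∈ K, μ.real {x : UI | (x : ℝ) < (1 / 2 : ℝ) ^ (n + S)} :=
        Finset.sum_le_sum fun k _ => measureReal_cell_le hinv hper _ k
    _ ≤ _ := by
        rw [Finset.sum_const, nsmul_eq_mul]
        refine mul_le_mul_of_nonneg_right ?_ measureReal_nonneg
        rw [hK, Fin.card_filter_val_lt]
        exact_mod_cast min_le_right _ _

/-- At each level, the same cells are charged by all admissible measures, and the masses that such
a measure gives to these cells agree up to a factor independent of the level. -/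
theorem exists_active_cells (π : Equiv.Perm (Fin q)) :
    ∃ C : ℝ, 0 < C ∧ ∀ n, ∃ act : Finset (Fin (q * 2 ^ n)), ∀ μ : Measure UI,
      IsProbabilityMeasure μ → IsAdmissible π μ → ∃ m : ℝ,
        (∀ k ∉ act, μ.real (cell (q * 2 ^ n) k) = 0) ∧
        ∀ k ∈ act, m ≤ C * μ.real (cell (q * 2 ^ n) k) ∧ μ.real (cell (q * 2 ^ n) k) ≤ m := by
  classical
  obtain ⟨S, hS⟩ := exists_uniform_scale q
  refine ⟨(q * 2 ^ S : ℕ), cast_size_pos _, fun n => ?_⟩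
  refine ⟨Finset.univ.filter fun k => ∃ i : Fin (q * 2 ^ n), (i : ℕ) < q ∧
    (∀ μ : Measure UI, MeasurePreserving (rotOdo π) μ μ →
      μ (cell (q * 2 ^ n) k) = μ (cell (q * 2 ^ n) i)) ∧
    ∃ t, block (q * 2 ^ n) ((rotOdo π)^[t] zero) = i, fun μ _ hμ => ?_⟩
  refine ⟨μ.real {x : UI | (x : ℝ) < (1 / 2 : ℝ) ^ n}, fun k hk => ?_, fun k hk => ?_⟩
  · rw [Finset.mem_filter] at hk
    rw [measureReal_def]
    rcases cell_periodic_or_measure_eq π n k with h | ⟨i, hi, h⟩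
    · rw [measure_mono_null h hμ.perPart_null, ENNReal.toReal_zero]
    · rw [h μ hμ.invariant, hμ.unvisited_null n i, ENNReal.toReal_zero]
      exact fun t ht => hk ⟨Finset.mem_univ _, i, hi, h, t, ht⟩
  · obtain ⟨-, i, hi, h, hvis⟩ := Finset.mem_filter.1 hk
    refine ⟨?_, measureReal_cell_le hμ.invariant hμ.perPart_null n k⟩
    refine (measureReal_lt_half_pow_le hμ.invariant hμ.perPart_null n S).trans ?_
    refine mul_le_mul_of_nonneg_left ?_ (Nat.cast_nonneg _)
    obtain ⟨K, hK⟩ := exists_iterate_subset_cell hS π n hi hvis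
    have hpre : μ ((rotOdo π)^[K] ⁻¹' cell (q * 2 ^ n) i) = μ (cell (q * 2 ^ n) i) :=
      (hμ.invariant.iterate K).measure_preimage (measurableSet_cell i).nullMeasurableSet
    rw [measureReal_def (s := cell (q * 2 ^ n) k), h μ hμ.invariant, ← hpre]
    exact measureReal_mono fun z hz => hK z hz

/-- The masses of all cells under two admissible measures are comparable. -/
theorem IsAdmissible.absolutelyContinuous {μ ν : Measure UI} [IsProbabilityMeasure μ]
    [IsProbabilityMeasure ν] (hμ : IsAdmissible π μ) (hν : IsAdmissible π ν) : ν ≪ μ := by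
  classical
  obtain ⟨C, hC, hact⟩ := exists_active_cells π
  have hsum : ∀ (ρ : Measure UI) [IsProbabilityMeasure ρ] (n : ℕ),
      ∑ k, ρ.real (cell (q * 2 ^ n) k) = 1 := by
    intro ρ _ n
    have h1 := measureReal_eq_sum_cell ρ (N := q * 2 ^ n) (A := univ) fun _ _ _ _ => mem_univ _
    rw [probReal_univ] at h1
    refine Eq.trans ?_ h1.symm
    simp
  have hle : ν ≤ ENNReal.ofReal (C ^ 2) • μ := by
    have : IsFiniteMeasure (ENNReal.ofReal (C ^ 2) • μ) := μ.smul_finite ENNReal.ofReal_ne_top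
    refine measure_le_of_cell_le q fun n k => ?_
    obtain ⟨act, h⟩ := hact n
    obtain ⟨a, ha0, ha⟩ := h μ inferInstance hμ
    obtain ⟨b, hb0, hb⟩ := h ν inferInstance hν
    have hreal : ν.real (cell (q * 2 ^ n) k) ≤ C ^ 2 * μ.real (cell (q * 2 ^ n) k) := by
      by_cases hk : k ∈ act
      · have hμs : ∑ l ∈ act, μ.real (cell (q * 2 ^ n) l) = 1 :=
          (Finset.sum_subset (Finset.subset_univ _) fun l _ hl => ha0 l hl).trans (hsum μ n)
        have hνs : ∑ l ∈ act, ν.real (cell (q * 2 ^ n) l) = 1 :=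
          (Finset.sum_subset (Finset.subset_univ _) fun l _ hl => hb0 l hl).trans (hsum ν n)
        have h1 : 1 ≤ (act.card : ℝ) * a := by
          rw [← hμs, ← nsmul_eq_mul, ← Finset.sum_const]
          exact Finset.sum_le_sum fun l hl => (ha l hl).2
        have h2 : (act.card : ℝ) * b ≤ C := by
          rw [← mul_one C, ← hνs, Finset.mul_sum, ← nsmul_eq_mul, ← Finset.sum_const]
          exact Finset.sum_le_sum fun l hl => (hb l hl).1
        have hcard : (0 : ℝ) < act.card := by
          exact_mod_cast Finset.card_pos.2 ⟨k, hk⟩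
        have h3 : b ≤ C * a := by
          have : (act.card : ℝ) * b ≤ act.card * (C * a) := by nlinarith
          exact le_of_mul_le_mul_left this hcard
        have h4 := (ha k hk).1
        have h5 := (hb k hk).2
        nlinarith
      · rw [ha0 k hk, hb0 k hk, mul_zero]
    rw [Measure.smul_apply, smul_eq_mul, ← ENNReal.ofReal_toReal (measure_ne_top ν _),
      ← ENNReal.ofReal_toReal (measure_ne_top μ (cell _ k)), ← ENNReal.ofReal_mul (by positivity)]
    exact ENNReal.ofReal_le_ofReal hreal
  exact (Measure.absolutelyContinuous_of_le hle).trans Measure.smul_absolutelyContinuous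

theorem IsAdmissible.cond {μ : Measure UI} [IsProbabilityMeasure μ] (hμ : IsAdmissible π μ)
    {s : Set UI} (hs : MeasurableSet s) (hinv : rotOdo π ⁻¹' s = s) :
    IsAdmissible π (ProbabilityTheory.cond μ s) := by
  have hac : ProbabilityTheory.cond μ s ≪ μ := ProbabilityTheory.cond_absolutelyContinuous
  refine ⟨?_, hac hμ.perPart_null, fun n i h => hac (hμ.unvisited_null n i h)⟩
  have h1 := hμ.invariant.restrict_preimage hs
  rw [hinv] at h1
  exact h1.smul_measure _

/-- The restrictions to an invariant set and to its complement cannot both be nonzero, being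
mutually singular. -/
theorem IsAdmissible.ergodic {μ : Measure UI} [IsProbabilityMeasure μ] (hμ : IsAdmissible π μ) :
    Ergodic (rotOdo π) μ := by
  refine ⟨hμ.invariant, ⟨fun s hs hinv => ?_⟩⟩
  rw [eventuallyConst_set', ae_eq_empty, ae_eq_univ]
  by_contra! hc
  have h1 : IsProbabilityMeasure (ProbabilityTheory.cond μ s) :=
    ProbabilityTheory.cond_isProbabilityMeasure hc.1
  have h2 : IsProbabilityMeasure (ProbabilityTheory.cond μ sᶜ) :=
    ProbabilityTheory.cond_isProbabilityMeasure hc.2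
  have hac := (hμ.cond hs.compl (by rw [preimage_compl, hinv])).absolutelyContinuous
    (hμ.cond hs hinv)
  have h3 : ProbabilityTheory.cond μ sᶜ s = 0 := by
    rw [ProbabilityTheory.cond_apply hs.compl, compl_inter_self, measure_empty, mul_zero]
  have h4 := hac h3
  rw [ProbabilityTheory.cond_apply hs, inter_self,
    ENNReal.inv_mul_cancel hc.1 (measure_ne_top _ _)] at h4
  exact one_ne_zero h4

theorem IsAdmissible.unique {μ ν : Measure UI} [IsProbabilityMeasure μ] [IsProbabilityMeasure ν]
    (hμ : IsAdmissible π μ) (hν : IsAdmissible π ν) : μ = ν :=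
  (hμ.ergodic.eq_of_absolutelyContinuous hν.invariant (hμ.absolutelyContinuous hν)).symm

end Comparison

/-! ### Existence of an invariant measure on the minimal set -/

section Existence

variable {q : ℕ} [NeZero q] {π : Equiv.Perm (Fin q)}

theorem exists_invariant_minimalSet (π : Equiv.Perm (Fin q)) : ∃ μ : Measure (IStar π),
    IsProbabilityMeasure μ ∧ μ (minimalSet π)ᶜ = 0 ∧ MeasurePreserving (starMap π) μ μ := by
  obtain ⟨hne, hclosed, hmaps⟩ := isSubsystem_minimalSet (π := π)
  have hcomp : CompactSpace (minimalSet π) := isCompact_iff_compactSpace.1 hclosed.isCompact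
  have hne' : Nonempty (minimalSet π) := hne.to_subtype
  have hT : Continuous (hmaps.restrict (starMap π) (minimalSet π) (minimalSet π)) :=
    continuous_starMap.continuousOn.mapsToRestrict hmaps
  obtain ⟨μ, hμ, hinv⟩ := hT.exists_measurePreserving
  refine ⟨μ.map Subtype.val, Measure.isProbabilityMeasure_map measurable_subtype_coe.aemeasurable,
    ?_, continuous_starMap.measurable, ?_⟩
  · rw [Measure.map_apply measurable_subtype_coe hclosed.measurableSet.compl]
    simp [preimage_compl]
  · conv_rhs => rw [← hinv.map_eq]
    rw [Measure.map_map continuous_starMap.measurable measurable_subtype_coe,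
      Measure.map_map measurable_subtype_coe hinv.measurable]
    rfl

/-! ### Invariant measures of the minimal set as measures on `I` -/

open Classical in
/-- The left inverse of the inclusion of `I` in `I^*` that sends all points `x⁻` to `0`. -/
def proj (z : IStar π) : UI := if h : z.sign = true then ⟨z.pos, z.pos_mem h⟩ else zero

theorem proj_incl (x : UI) : proj (incl π x) = x := dif_pos (incl_sign x)

theorem measurableSet_minus : MeasurableSet {z : IStar π | z.sign = false} :=
  countable_minus.measurableSet

theorem measurable_proj : Measurable (proj : IStar π → UI) := by
  classical
  rw [← MeasurableEmbedding.measurable_comp_iff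
    (MeasurableEmbedding.subtype_coe measurableSet_Ico)]
  have : (((↑) : UI → ℝ) ∘ proj : IStar π → ℝ) = fun z => if z.sign = false then 0 else z.pos := by
    funext z
    rw [Function.comp_apply, proj]
    by_cases h : z.sign = true
    · rw [dif_pos h, if_neg (by rw [h]; decide)]
    · rw [dif_neg h, if_pos (Bool.eq_false_iff.2 h)]
      rfl
  rw [this]
  exact Measurable.ite measurableSet_minus measurable_const continuous_pos.measurable

theorem measurable_incl : Measurable (incl π) := by
  refine measurable_of_Iio fun z => ?_
  have h : ∀ b : ℝ, MeasurableSet {x : UI | (x : ℝ) < b} := fun b =>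
    measurableSet_lt measurable_subtype_coe measurable_const
  rcases z.exists_eq with ⟨y, rfl⟩ | ⟨b, hb, rfl⟩
  · convert h y using 1
    ext x
    exact incl_lt_iff
  · convert h b using 1
    ext x
    exact lt_minus_iff

section Transfer

variable {μ : Measure (IStar π)} [IsProbabilityMeasure μ]

/-- The minimal set contains no periodic point, so by recurrence its invariant measures have no
atoms. -/
theorem measure_singleton_eq_zero (hM : μ (minimalSet π)ᶜ = 0)
    (hinv : MeasurePreserving (starMap π) μ μ) (z : IStar π) : μ {z} = 0 := by
  by_contra h
  have hz : z ∈ minimalSet π := by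
    by_contra hz
    exact h (measure_mono_null (singleton_subset_iff.2 hz) hM)
  obtain ⟨w, hw, m, hm, hmw⟩ := hinv.exists_mem_iterate_mem
    (measurableSet_singleton z).nullMeasurableSet h
  rw [mem_singleton_iff] at hw hmw
  rw [hw] at hmw
  exact iterate_ne_of_mem_minimalSet hz hm hmw

theorem measure_minus_eq_zero (hM : μ (minimalSet π)ᶜ = 0)
    (hinv : MeasurePreserving (starMap π) μ μ) : μ {z : IStar π | z.sign = false} = 0 := by
  rw [← biUnion_of_singleton {z : IStar π | z.sign = false},
    measure_biUnion_null_iff countable_minus]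
  exact fun z _ => measure_singleton_eq_zero hM hinv z

theorem ae_exists_incl_eq (hM : μ (minimalSet π)ᶜ = 0)
    (hinv : MeasurePreserving (starMap π) μ μ) : ∀ᵐ z ∂μ, ∃ x, z = incl π x := by
  have h : ∀ᵐ z ∂μ, ¬ z.sign = false := measure_eq_zero_iff_ae_notMem.1
    (measure_minus_eq_zero hM hinv)
  filter_upwards [h] with z hz
  rcases z.exists_eq with ⟨x, rfl⟩ | ⟨b, hb, rfl⟩
  · exact ⟨x, rfl⟩
  · exact absurd (minus_sign hb) hz

theorem map_incl_map_proj (hM : μ (minimalSet π)ᶜ = 0)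
    (hinv : MeasurePreserving (starMap π) μ μ) : (μ.map proj).map (incl π) = μ := by
  rw [Measure.map_map measurable_incl measurable_proj]
  conv_rhs => rw [← Measure.map_id (μ := μ)]
  refine Measure.map_congr ?_
  filter_upwards [ae_exists_incl_eq hM hinv] with z hz
  obtain ⟨x, rfl⟩ := hz
  rw [Function.comp_apply, proj_incl, id]

theorem isAdmissible_map_proj (hM : μ (minimalSet π)ᶜ = 0)
    (hinv : MeasurePreserving (starMap π) μ μ) : IsAdmissible π (μ.map proj) := by
  have hincl := ae_exists_incl_eq hM hinv
  have hmin : ∀ᵐ z ∂μ, z ∈ minimalSet π := by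
    filter_upwards [measure_eq_zero_iff_ae_notMem.1 hM] with z hz
    exact not_not.1 hz
  refine ⟨⟨measurable_rotOdo π, ?_⟩, ?_, fun n i hi => ?_⟩
  · rw [Measure.map_map (measurable_rotOdo π) measurable_proj]
    conv_rhs => rw [← hinv.map_eq]
    rw [Measure.map_map measurable_proj hinv.measurable]
    refine Measure.map_congr ?_
    filter_upwards [hincl] with z hz
    obtain ⟨x, rfl⟩ := hz
    rw [Function.comp_apply, Function.comp_apply, starMap_incl, proj_incl, proj_incl]
  · rw [Measure.map_apply measurable_proj (measurableSet_perPart π),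
      measure_eq_zero_iff_ae_notMem]
    filter_upwards [hincl, hmin] with z hz hzM hper
    obtain ⟨x, rfl⟩ := hz
    rw [mem_preimage, proj_incl] at hper
    exact minimalSet_subset hzM (incl_mem_starPerPart_iff.2 hper)
  · have hN := cast_size_pos (q * 2 ^ n)
    -- the interior of the cell is seen as an open subset of `I^*`; its left endpoint is negligible
    have hpt := measure_eq_zero_iff_ae_notMem.1
      (measure_singleton_eq_zero hM hinv (incl π (leftEnd (q * 2 ^ n) i)))
    rw [Measure.map_apply measurable_proj (measurableSet_cell i), measure_eq_zero_iff_ae_notMem]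
    filter_upwards [hincl, hmin, hpt] with z hz hzM hzpt hcell
    obtain ⟨x, rfl⟩ := hz
    rw [mem_preimage, proj_incl] at hcell
    obtain ⟨h1, h2⟩ := block_eq_iff.1 (show block (q * 2 ^ n) x = i from hcell)
    have h3 : ((i : ℕ) : ℝ) < (q * 2 ^ n : ℕ) * (x : ℝ) := by
      refine lt_of_le_of_ne h1 fun h => hzpt ?_
      rw [mem_singleton_iff]
      congr 1
      apply Subtype.ext
      change (x : ℝ) = ((i : ℕ) : ℝ) / ((q * 2 ^ n : ℕ) : ℝ)
      rw [h]
      field_simp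
    set O : Set (IStar π) := {w | ((i : ℕ) : ℝ) < (q * 2 ^ n : ℕ) * w.pos ∧
      ((q * 2 ^ n : ℕ) : ℝ) * w.pos < (i : ℕ) + 1} with hO
    have hOopen : IsOpen O :=
      (isOpen_lt continuous_const (continuous_const.mul continuous_pos)).inter
        (isOpen_lt (continuous_const.mul continuous_pos) continuous_const)
    have hsub : minimalSet π ⊆ Oᶜ := by
      refine closure_minimal ?_ hOopen.isClosed_compl
      rintro _ ⟨k, rfl⟩ hk
      exact hi k (block_eq_iff.2 ⟨hk.1.le, hk.2⟩)
    exact hsub hzM ⟨h3, h2⟩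

end Transfer

theorem isUniquelyErgodicOn_minimalSet (π : Equiv.Perm (Fin q)) :
    IsUniquelyErgodicOn (starMap π) (minimalSet π) := by
  obtain ⟨μ, hμ⟩ := exists_invariant_minimalSet π
  refine ⟨μ, hμ, fun ν hν => ?_⟩
  obtain ⟨hμ1, hμ2, hμ3⟩ := hμ
  obtain ⟨hν1, hν2, hν3⟩ := hν
  have h1 : IsProbabilityMeasure (μ.map proj) :=
    Measure.isProbabilityMeasure_map measurable_proj.aemeasurable
  have h2 : IsProbabilityMeasure (ν.map proj) :=
    Measure.isProbabilityMeasure_map measurable_proj.aemeasurable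
  rw [← map_incl_map_proj hμ2 hμ3, ← map_incl_map_proj hν2 hν3,
    (isAdmissible_map_proj hν2 hν3).unique (isAdmissible_map_proj hμ2 hμ3)]

end Existence

end RotatedOdometer

end

theorem theorem1p5 (q : ℕ) [NeZero q] (π : Equiv.Perm (Fin q)) :
    (RotatedOdometer.ergodicMeasures π).encard ≤ q ∧
    ∃ M : Set (RotatedOdometer.IStar π),
      RotatedOdometer.IsMinimalIn (RotatedOdometer.starMap π) (RotatedOdometer.starNpPart π) M ∧
      (∀ M' : Set (RotatedOdometer.IStar π),
        RotatedOdometer.IsMinimalIn (RotatedOdometer.starMap π) (RotatedOdometer.starNpPart π) M' →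
          M' = M) ∧
      RotatedOdometer.IsUniquelyErgodicOn (RotatedOdometer.starMap π) M :=
  ⟨RotatedOdometer.encard_ergodicMeasures_le π, RotatedOdometer.minimalSet π,
    RotatedOdometer.isMinimalIn_minimalSet, fun _ h => RotatedOdometer.eq_minimalSet h,
    RotatedOdometer.isUniquelyErgodicOn_minimalSet π⟩
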